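/- Let $\theta,\rho$ be real numbers with $|\theta|<1$, $|\rho|<1$, $\theta\neq 0$ and $\rho\neq 0$. Let $(V_n)_{n\ge 1}$ be a sequence of independent and identically distributed real random variables with mean zero, variance $\sigma^2>0$ and a finite moment of order $4$. Let the initial values $X_0$ and $\varepsilon_0$ be arbitrary real random variables (not assumed independent of $(V_n)$), and for all $n\geq 1$ let $$X_n=\theta X_{n-1}+\varepsilon_n,\qquad \varepsilon_n=\rho\,\varepsilon_{n-1}+V_n .$$ For $n\ge 1$ put $$\widehat\theta_n=\frac{\sum_{k=1}^n X_kX_{k-1}}{\sum_{k=1}^n X_{k-1}^2},$$ let $\widehat\varepsilon_0=X_0$ and $\widehat\varepsilon_k=X_k-\widehat\theta_n X_{k-1}$ for $1\le k\le n$ be the residuals at step $n$, and let $$\widehat D_n=\frac{\sum_{k=1}^n(\widehat\varepsilon_k-\widehat\varepsilon_{k-1})^2}{\sum_{k=0}^n\widehat\varepsilon_k^{\,2}}$$ be the Durbin-Watson statistic. Let also, for $n\ge 2$, $$\widehat\vartheta_n^{\,2}=\frac{\sum_{k=2}^n X_{k-2}X_k}{\sum_{k=2}^n X_{k-2}^2},\qquad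 T_n=\frac{n\,(1-\widehat\vartheta_n^{\,2})}{4(\widehat\vartheta_n^{\,2})^2(1+\widehat\vartheta_n^{\,2})}\,(\widehat D_n-2)^2,$$ where $\widehat\vartheta_n^{\,2}$ is a single symbol (the least squares estimator of $\theta^2$, which may take negative values). (Quotients with zero denominator are given the value $0$; this does not affect the conclusions.) If $\theta=-\rho$, then $T_n$ converges in law, as $n\to\infty$, to the Chi-square distribution with one degree of freedom. If $\theta\neq-\rho$, then $T_n\to+\infty$ almost surely. -/

import Mathlib

open MeasureTheory ProbabilityTheory Filter

noncomputable section

namespace DurbinWatson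

variable {Ω : Type*}

/-- The least squares estimator of `θ` at step `n`:
`θ̂ₙ = (∑_{k=1}^n X_k X_{k-1}) / (∑_{k=1}^n X_{k-1}²)`. -/
def thetaHat (X : ℕ → Ω → ℝ) (n : ℕ) (ω : Ω) : ℝ :=
  (∑ k ∈ Finset.Icc 1 n, X k ω * X (k - 1) ω) / ∑ k ∈ Finset.Icc 1 n, X (k - 1) ω ^ 2

/-- The least squares residuals computed at step `n`: `ε̂₀ = X₀` and
`ε̂_k = X_k - θ̂ₙ X_{k-1}` for `k ≥ 1`. All of them use the estimator `θ̂ₙ` of step `n`. -/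
def residual (X : ℕ → Ω → ℝ) (n k : ℕ) (ω : Ω) : ℝ :=
  if k = 0 then X 0 ω else X k ω - thetaHat X n ω * X (k - 1) ω

/-- The Durbin-Watson statistic
`D̂ₙ = (∑_{k=1}^n (ε̂_k - ε̂_{k-1})²) / (∑_{k=0}^n ε̂_k²)`. -/
def dwStat (X : ℕ → Ω → ℝ) (n : ℕ) (ω : Ω) : ℝ :=
  (∑ k ∈ Finset.Icc 1 n, (residual X n k ω - residual X n (k - 1) ω) ^ 2) /
    ∑ k ∈ Finset.Icc 0 n, residual X n k ω ^ 2

/-- The lag-two least squares estimator of `θ²`: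
`(∑_{k=2}^n X_{k-2} X_k) / (∑_{k=2}^n X_{k-2}²)`. -/
def varthetaSqHat (X : ℕ → Ω → ℝ) (n : ℕ) (ω : Ω) : ℝ :=
  (∑ k ∈ Finset.Icc 2 n, X (k - 2) ω * X k ω) / ∑ k ∈ Finset.Icc 2 n, X (k - 2) ω ^ 2

/-- The test statistic `n (1 - v) / (4 v² (1 + v)) * (D̂ₙ - 2)²`, where `v` is the
lag-two least squares estimator of `θ²`. -/
def testStat (X : ℕ → Ω → ℝ) (n : ℕ) (ω : Ω) : ℝ :=
  (n : ℝ) * (1 - varthetaSqHat X n ω) /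
      (4 * varthetaSqHat X n ω ^ 2 * (1 + varthetaSqHat X n ω)) * (dwStat X n ω - 2) ^ 2

/-- The Chi-square distribution with one degree of freedom: the law of `Z²` for a standard
normal random variable `Z`. -/
def chiSquareOne : Measure ℝ := (gaussianReal 0 1).map (fun x ↦ x ^ 2)

instance isProbabilityMeasure_chiSquareOne : IsProbabilityMeasure chiSquareOne :=
  Measure.isProbabilityMeasure_map (by fun_prop)

end DurbinWatson

end

/-!
With `W i = V (i + 1)`, the observations satisfy the second order recursion
`X (k + 2) = (θ + ρ) X (k + 1) - θ ρ X k + W (k + 1)`. Multiplying it by `X (k + 1)` or `X k`,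
squaring it, and summing expresses the averages of `X k ^ 2`, `X (k + 1) X k` and `X (k + 2) X k`
through boundary terms, the average of `W k ^ 2` and the averages of `X k W k` and `X k W (k + 1)`
(`tendsto_quadratic_averages`). The last two are martingales up to the effect of the initial values,
which decays geometrically (`path_limits`); they obey a strong law by martingale convergence and
Kronecker's lemma (`IsNoise.ae_tendsto_average`). Thus `θ̂ₙ`, `D̂ₙ` and the lag-two estimator
converge almost surely to explicit limits.

Expanding the square and using the normal equation for `θ̂ₙ` gives the exact formula
`dwStat_sub_two`: `D̂ₙ - 2` is `-2 θ̂ₙ (θ̂ₙ ∑ X_{k+1} X_k - ∑ X_{k+2} X_k)`, minus the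
squares of the first and last residuals, over the residual sum of squares.

* If `θ ≠ -ρ`, the limit of `D̂ₙ - 2` is not zero, and the lag-two autocorrelation lies in `(0, 1)`
  (`limCorrTwo_mem`), so the test statistic grows linearly (`tendsto_testStat_atTop`).
* If `θ = -ρ`, the recursion is `X (k + 2) = θ² X k + W (k + 1)` and `θ̂ₙ → 0`. Then `√n (D̂ₙ - 2)`
  is, up to a null sequence, a convergent multiple of `∑ X k W k / √n` (`tendsto_linearization`).
  The initial values being negligible, `X` may be replaced in this sum by the process `y` started at
  zero, and a central limit theorem and Slutsky's theorem conclude.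

The central limit theorem for `M n = ∑_{i<n} y i W i` is proved with characteristic functions. A
Taylor expansion of `E[exp (i t M (k + 1))]` produces the factor `1 - t² σ² s / 2`, with `s` the
limiting variance, an error proportional to `E[exp (i t M k) (y k ² - s)]`, and a remainder
`O(t³)`. By the recursion for
`y`, this correlation contracts by the factor `θ⁴` every second step, up to `O(t)`. So the errors
sum to a negligible quantity at the frequency `t / √n`. This is where fourth moments enter; they
are also used to show that the boundary terms are `o(√n)`.
-/

namespace DurbinWatson

open Asymptotics Topology

/-! ### Deterministic autoregressive recursions -/

/-- Convexity of `x ↦ x ^ 4`: an autoregression contracts fourth powers, with factor `|a|`. -/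
lemma mul_add_pow_four_le {a : ℝ} (ha : |a| < 1) (x e : ℝ) :
    (a * x + e) ^ 4 ≤ |a| * x ^ 4 + e ^ 4 / (1 - |a|) ^ 3 := by
  have hb : 0 < 1 - |a| := by linarith
  have hconv := (Even.convexOn_pow (𝕜 := ℝ) (n := 4) (by decide)).2
    (Set.mem_univ (SignType.sign a * x)) (Set.mem_univ (e / (1 - |a|)))
    (abs_nonneg a) hb.le (by ring)
  simp only [smul_eq_mul] at hconv
  have h1 : |a| * (SignType.sign a * x) + (1 - |a|) * (e / (1 - |a|)) = a * x + e := by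
    rw [mul_div_cancel₀ _ hb.ne', ← mul_assoc, abs_mul_sign]
  have h2 : (1 - |a|) * (e / (1 - |a|)) ^ 4 = e ^ 4 / (1 - |a|) ^ 3 := by
    field_simp
  have h3 : |a| * ((SignType.sign a : ℝ) * x) ^ 4 ≤ |a| * x ^ 4 := by
    rcases lt_trichotomy a 0 with h | h | h
    · simp [sign_neg h, Even.neg_pow (show Even 4 by decide)]
    · simp [h]
    · simp [sign_pos h]
  rw [h1, h2] at hconv
  linarith

/-- A nonnegative sequence that contracts up to a vanishing error tends to zero. -/
lemma tendsto_zero_of_le_mul_add {u b : ℕ → ℝ} {r : ℝ} (hr0 : 0 ≤ r) (hr : r < 1)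
    (hu : ∀ n, 0 ≤ u n) (hb : Tendsto b atTop (𝓝 0)) (h : ∀ n, u (n + 1) ≤ r * u n + b n) :
    Tendsto u atTop (𝓝 0) := by
  rw [Metric.tendsto_atTop]
  intro δ hδ
  obtain ⟨N, hN⟩ := eventually_atTop.1
    (hb.eventually (gt_mem_nhds (show 0 < (1 - r) * (δ / 2) by nlinarith)))
  have key : ∀ k, u (N + k) ≤ δ / 2 + r ^ k * u N := by
    intro k
    induction k with
    | zero => simp; linarith
    | succ k ih =>
      have h1 := h (N + k)
      have h2 := hN (N + k) (by omega)
      calc u (N + (k + 1)) ≤ r * u (N + k) + b (N + k) := h1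
        _ ≤ r * (δ / 2 + r ^ k * u N) + (1 - r) * (δ / 2) := by gcongr
        _ = δ / 2 + r ^ (k + 1) * u N := by ring
  have hpow : Tendsto (fun k ↦ r ^ k * u N) atTop (𝓝 0) := by
    simpa using (tendsto_pow_atTop_nhds_zero_of_lt_one hr0 hr).mul_const (u N)
  obtain ⟨K, hK⟩ := eventually_atTop.1 (hpow.eventually (gt_mem_nhds (half_pos hδ)))
  refine ⟨N + K, fun n hn ↦ ?_⟩
  obtain ⟨k, rfl⟩ := Nat.exists_eq_add_of_le (show N ≤ n by omega)
  rw [Real.dist_0_eq_abs, abs_of_nonneg (hu _)]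
  linarith [key k, hK k (by omega)]

/-- An autoregressive recursion preserves the growth bound `o(n ^ (1 / 4))`. -/
lemma tendsto_pow_four_div_of_recursion {a : ℝ} (ha : |a| < 1) {x e : ℕ → ℝ}
    (h : ∀ n, x (n + 1) = a * x n + e n)
    (he : Tendsto (fun n : ℕ ↦ e n ^ 4 / ((n : ℝ) + 1)) atTop (𝓝 0)) :
    Tendsto (fun n : ℕ ↦ x n ^ 4 / ((n : ℝ) + 1)) atTop (𝓝 0) := by
  have hb : 0 < 1 - |a| := by linarith
  refine tendsto_zero_of_le_mul_add (abs_nonneg a) ha (fun n ↦ by positivity)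
    (by simpa using he.div_const ((1 - |a|) ^ 3)) fun n ↦ ?_
  have hn : (0 : ℝ) < n + 1 := by positivity
  calc x (n + 1) ^ 4 / ((n + 1 : ℕ) + 1 : ℝ) ≤ x (n + 1) ^ 4 / (n + 1) := by
        gcongr; linarith
    _ ≤ (|a| * x n ^ 4 + e n ^ 4 / (1 - |a|) ^ 3) / (n + 1) := by
        gcongr; rw [h]; exact mul_add_pow_four_le ha _ _
    _ = _ := by ring

/-- If `∑_{i<n} f i / n` converges then `f n = o(n)`. -/
lemma tendsto_div_of_tendsto_average {f : ℕ → ℝ} {l : ℝ}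
    (h : Tendsto (fun n : ℕ ↦ (∑ i ∈ Finset.range n, f i) / n) atTop (𝓝 l)) :
    Tendsto (fun n : ℕ ↦ f n / ((n : ℝ) + 1)) atTop (𝓝 0) := by
  have h1 := (tendsto_add_atTop_iff_nat 1).2 h
  have h2 := h.mul (tendsto_natCast_div_add_atTop (1 : ℝ))
  have h3 := h1.sub h2
  simp only [mul_one, sub_self] at h3
  refine h3.congr fun n ↦ ?_
  rw [Finset.sum_range_succ]
  push_cast
  rcases eq_or_ne (n : ℝ) 0 with h0 | h0
  · have : n = 0 := by exact_mod_cast h0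
    subst this; simp
  · field_simp
    ring

/-- The difference of two solutions with the same innovations decays geometrically. -/
lemma exists_geometric_bound {θ ρ : ℝ} (hθ : |θ| < 1) (hρ : |ρ| < 1) {c : ℕ → ℝ} {B : ℝ}
    (h : ∀ n, c (n + 1) = θ * c n + ρ ^ (n + 1) * B) :
    ∃ r K : ℝ, 0 ≤ r ∧ r < 1 ∧ ∀ n, |c n| ≤ K * r ^ n := by
  obtain ⟨r, hr1, hr2⟩ := exists_between (max_lt hθ hρ)
  have hθr := (le_max_left _ _).trans_lt hr1
  have hρr := (le_max_right _ _).trans_lt hr1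
  have hr0 : 0 < r := (abs_nonneg θ).trans_lt hθr
  have hd : 0 < r - |θ| := by linarith
  refine ⟨r, |c 0| + r * |B| / (r - |θ|), hr0.le, hr2, fun n ↦ ?_⟩
  induction n with
  | zero => simp; positivity
  | succ n ih =>
    set K := |c 0| + r * |B| / (r - |θ|) with hK
    have hKB : r * |B| ≤ K * (r - |θ|) := by
      rw [hK, add_mul, div_mul_cancel₀ _ hd.ne']
      have := mul_nonneg (abs_nonneg (c 0)) hd.le
      linarith
    calc |c (n + 1)| = |θ * c n + ρ ^ (n + 1) * B| := by rw [h]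
      _ ≤ |θ| * |c n| + |ρ| ^ (n + 1) * |B| := by
        refine (abs_add_le _ _).trans (le_of_eq ?_); simp [abs_mul, abs_pow]
      _ ≤ |θ| * (K * r ^ n) + r ^ (n + 1) * |B| := by gcongr
      _ = |θ| * (K * r ^ n) + r ^ n * (r * |B|) := by ring
      _ ≤ |θ| * (K * r ^ n) + r ^ n * (K * (r - |θ|)) := by gcongr
      _ = K * r ^ (n + 1) := by ring

lemma summable_geometric_mul {c w : ℕ → ℝ} {r K : ℝ} (hr0 : 0 ≤ r) (hr : r < 1)
    (hc : ∀ n, |c n| ≤ K * r ^ n)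
    (hw : Tendsto (fun n : ℕ ↦ w n ^ 4 / ((n : ℝ) + 1)) atTop (𝓝 0)) :
    Summable fun n ↦ c n * w n := by
  -- `w n` grows at most linearly, which is enough against a geometric factor
  obtain ⟨C, hC⟩ := hw.bddAbove_range
  have hw' : ∀ n : ℕ, |w n| ≤ (1 + C) * ((n : ℝ) + 1) := by
    intro n
    have h1 : w n ^ 4 / ((n : ℝ) + 1) ≤ C := hC ⟨n, rfl⟩
    rw [div_le_iff₀ (by positivity)] at h1
    have h2 : |w n| ≤ 1 + w n ^ 4 := by
      rw [← (show Even 4 by decide).pow_abs (w n)]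
      nlinarith [sq_nonneg (|w n| ^ 2 - 1 / 2), sq_nonneg (|w n| - 1 / 2)]
    have : (0 : ℝ) ≤ n := by positivity
    nlinarith
  have hs : Summable fun n : ℕ ↦ K * (1 + C) * ((n : ℝ) ^ 1 * r ^ n + r ^ n) :=
    ((summable_pow_mul_geometric_of_norm_lt_one 1 (by rwa [Real.norm_of_nonneg hr0])).add
      (summable_geometric_of_lt_one hr0 hr)).mul_left _
  refine Summable.of_norm_bounded hs fun n ↦ ?_
  have hK : 0 ≤ K * r ^ n := (abs_nonneg _).trans (hc n)
  calc ‖c n * w n‖ = |c n| * |w n| := by rw [Real.norm_eq_abs, abs_mul]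
    _ ≤ (K * r ^ n) * ((1 + C) * ((n : ℝ) + 1)) := by gcongr; exacts [hc n, hw' n]
    _ = _ := by ring

/-! ### Limits of the quadratic averages -/

lemma isLittleO_natCast_iff {f : ℕ → ℝ} :
    f =o[atTop] (fun n : ℕ ↦ (n : ℝ)) ↔ Tendsto (fun n : ℕ ↦ f n / n) atTop (𝓝 0) :=
  isLittleO_iff_tendsto' <| (eventually_gt_atTop 0).mono fun n hn h ↦ by
    have : (n : ℝ) ≠ 0 := by positivity
    exact absurd h this

lemma isBigO_natCast_add_one : (fun n : ℕ ↦ ((n + 1 : ℕ) : ℝ)) =O[atTop] (fun n : ℕ ↦ (n : ℝ)) :=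
  IsBigO.of_bound 2 <| (eventually_ge_atTop 1).mono fun n hn ↦ by
    have : (1 : ℝ) ≤ n := by exact_mod_cast hn
    rw [Real.norm_of_nonneg (by positivity), Real.norm_of_nonneg (by positivity)]
    push_cast; linarith

lemma isLittleO_natCast_succ {f : ℕ → ℝ} (h : f =o[atTop] (fun n : ℕ ↦ (n : ℝ))) :
    (fun n ↦ f (n + 1)) =o[atTop] (fun n : ℕ ↦ (n : ℝ)) :=
  (h.comp_tendsto (tendsto_add_atTop_nat 1)).trans_isBigO isBigO_natCast_add_one

lemma isLittleO_const_natCast (c : ℝ) : (fun _ : ℕ ↦ c) =o[atTop] (fun n : ℕ ↦ (n : ℝ)) :=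
  isLittleO_natCast_iff.2 (tendsto_const_div_atTop_nhds_zero_nat c)

lemma isLittleO_mul_of_sq {f g h : ℕ → ℝ} (hf : (fun n ↦ f n ^ 2) =o[atTop] h)
    (hg : (fun n ↦ g n ^ 2) =o[atTop] h) : (fun n ↦ f n * g n) =o[atTop] h := by
  refine (IsBigO.of_bound 1 (Eventually.of_forall fun n ↦ ?_)).trans_isLittleO (hf.add hg)
  rw [one_mul, Real.norm_eq_abs, Real.norm_of_nonneg (by positivity), abs_mul]
  nlinarith [sq_abs (f n), sq_abs (g n), sq_nonneg (|f n| - |g n|), abs_nonneg (f n),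
    abs_nonneg (g n)]

/-- `f n ^ 4 = o(n)` gives `f n ^ 2 = o(√n)`. -/
lemma isLittleO_sq_sqrt {f : ℕ → ℝ}
    (h : Tendsto (fun n : ℕ ↦ f n ^ 4 / ((n : ℝ) + 1)) atTop (𝓝 0)) :
    (fun n ↦ f n ^ 2) =o[atTop] (fun n : ℕ ↦ √(n : ℝ)) := by
  have h1 : Tendsto (fun n : ℕ ↦ f n ^ 4 / n) atTop (𝓝 0) := by
    refine squeeze_zero' (Eventually.of_forall fun n ↦ by positivity) ?_
      (by simpa using h.const_mul 2)
    filter_upwards [eventually_ge_atTop 1] with n hn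
    have : (1 : ℝ) ≤ n := by exact_mod_cast hn
    rw [← mul_div_assoc, div_le_div_iff₀ (by positivity) (by positivity)]
    nlinarith [show 0 ≤ f n ^ 4 by positivity]
  have h2 := (Real.continuous_sqrt.tendsto 0).comp h1
  rw [Real.sqrt_zero] at h2
  refine (isLittleO_iff_tendsto' ((eventually_gt_atTop 0).mono fun n hn h ↦ ?_)).2
    (h2.congr fun n ↦ ?_)
  · have : √(n : ℝ) ≠ 0 := by positivity
    exact absurd h this
  · rw [Function.comp_apply, Real.sqrt_div (by positivity), show f n ^ 4 = (f n ^ 2) ^ 2 by ring,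
      Real.sqrt_sq (by positivity)]

lemma isLittleO_sqrt_natCast : (fun n : ℕ ↦ √(n : ℝ)) =o[atTop] (fun n : ℕ ↦ (n : ℝ)) := by
  refine isLittleO_natCast_iff.2 ?_
  refine (tendsto_inv_atTop_zero.comp
    (Real.tendsto_sqrt_atTop.comp tendsto_natCast_atTop_atTop)).congr fun n ↦ ?_
  simp [Real.sqrt_div_self']

/-- `∑_{i<n} x_i²`. -/
noncomputable def sumSq (x : ℕ → ℝ) (n : ℕ) : ℝ := ∑ i ∈ Finset.range n, x i ^ 2

/-- The lag-one sum `∑_{i<n} x_{i+1} x_i`. -/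
noncomputable def sumLagOne (x : ℕ → ℝ) (n : ℕ) : ℝ := ∑ i ∈ Finset.range n, x (i + 1) * x i

/-- The lag-two sum `∑_{i<n} x_{i+2} x_i`. -/
noncomputable def sumLagTwo (x : ℕ → ℝ) (n : ℕ) : ℝ := ∑ i ∈ Finset.range n, x (i + 2) * x i

/-- The almost sure limit of `∑_{i<n} X_i² / n`. -/
noncomputable def limVar (θ ρ σ : ℝ) : ℝ :=
  σ ^ 2 * (1 + θ * ρ) / ((1 - θ * ρ) * (1 - θ ^ 2) * (1 - ρ ^ 2))

/-- The limiting lag-one autocorrelation. -/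
noncomputable def limCorr (θ ρ : ℝ) : ℝ := (θ + ρ) / (1 + θ * ρ)

section Quadratic

variable {x w : ℕ → ℝ} {a b : ℝ}

lemma sumLagOne_recursion (hrec : ∀ k, x (k + 2) = a * x (k + 1) + b * x k + w (k + 1)) (n : ℕ) :
    (1 - b) * sumLagOne x n - a * sumSq x n = (∑ i ∈ Finset.range n, x i * w i)
      + (a * x n ^ 2 + x n * w n - x (n + 1) * x n + x 1 * x 0 - a * x 0 ^ 2 - x 0 * w 0) := by
  induction n with
  | zero => simp [sumLagOne, sumSq]
  | succ n ih =>
    simp only [sumLagOne, sumSq, Finset.sum_range_succ] at ih ⊢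
    rw [hrec n]
    linear_combination ih

lemma sumLagTwo_recursion (hrec : ∀ k, x (k + 2) = a * x (k + 1) + b * x k + w (k + 1)) (n : ℕ) :
    sumLagTwo x n - a * sumLagOne x n - b * sumSq x n = ∑ i ∈ Finset.range n, x i * w (i + 1) := by
  induction n with
  | zero => simp [sumLagOne, sumSq, sumLagTwo]
  | succ n ih =>
    simp only [sumLagOne, sumSq, sumLagTwo, Finset.sum_range_succ] at ih ⊢
    rw [hrec n]
    linear_combination ih

lemma sumSq_recursion (hrec : ∀ k, x (k + 2) = a * x (k + 1) + b * x k + w (k + 1)) (n : ℕ) :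
    (1 - a ^ 2 - b ^ 2) * sumSq x n - 2 * a * b * sumLagOne x n =
      2 * a * (∑ i ∈ Finset.range n, x i * w i) + 2 * b * (∑ i ∈ Finset.range n, x i * w (i + 1))
      + (∑ i ∈ Finset.range n, w i ^ 2)
      + (a ^ 2 * x n ^ 2 - x n ^ 2 - x (n + 1) ^ 2 + 2 * a * (x n * w n) + w n ^ 2
        + (x 0 ^ 2 + x 1 ^ 2 - a ^ 2 * x 0 ^ 2 - 2 * a * (x 0 * w 0) - w 0 ^ 2)) := by
  induction n with
  | zero => simp [sumLagOne, sumSq]; ring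
  | succ n ih =>
    simp only [sumLagOne, sumSq, Finset.sum_range_succ] at ih ⊢
    rw [hrec n]
    linear_combination ih

end Quadratic

/-- The laws of large numbers for the quadratic sums of a second order autoregression, from those
for the sums involving the innovations. -/
lemma tendsto_quadratic_averages {θ ρ σ : ℝ} (hθ : |θ| < 1) (hρ : |ρ| < 1) {x w : ℕ → ℝ}
    (hrec : ∀ k, x (k + 2) = (θ + ρ) * x (k + 1) + -(θ * ρ) * x k + w (k + 1))
    (hx : (fun n ↦ x n ^ 2) =o[atTop] (fun n : ℕ ↦ (n : ℝ)))
    (hw : (fun n ↦ w n ^ 2) =o[atTop] (fun n : ℕ ↦ (n : ℝ)))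
    (h1 : Tendsto (fun n : ℕ ↦ (∑ i ∈ Finset.range n, w i ^ 2) / n) atTop (𝓝 (σ ^ 2)))
    (h2 : Tendsto (fun n : ℕ ↦ (∑ i ∈ Finset.range n, x i * w i) / n) atTop (𝓝 0))
    (h3 : Tendsto (fun n : ℕ ↦ (∑ i ∈ Finset.range n, x i * w (i + 1)) / n) atTop (𝓝 0)) :
    Tendsto (fun n : ℕ ↦ sumSq x n / n) atTop (𝓝 (limVar θ ρ σ)) ∧
    Tendsto (fun n : ℕ ↦ sumLagOne x n / n) atTop (𝓝 (limCorr θ ρ * limVar θ ρ σ)) ∧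
    Tendsto (fun n : ℕ ↦ sumLagTwo x n / n) atTop
      (𝓝 (((θ + ρ) * limCorr θ ρ - θ * ρ) * limVar θ ρ σ)) := by
  have hθ2 : 0 < 1 - θ ^ 2 := by nlinarith [sq_abs θ, abs_nonneg θ]
  have hρ2 : 0 < 1 - ρ ^ 2 := by nlinarith [sq_abs ρ, abs_nonneg ρ]
  have hθρ : |θ * ρ| < 1 := by rw [abs_mul]; nlinarith [abs_nonneg θ, abs_nonneg ρ]
  have hp : 0 < 1 + θ * ρ := by linarith [(abs_lt.1 hθρ).1]
  have hm : 0 < 1 - θ * ρ := by linarith [(abs_lt.1 hθρ).2]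
  have hx' := isLittleO_natCast_succ hx
  have hc := fun c : ℝ ↦ isLittleO_const_natCast c
  have hxx := isLittleO_mul_of_sq hx' hx
  have hxw := isLittleO_mul_of_sq hx hw
  have e2 := isLittleO_natCast_iff.2 h2
  have e3 := isLittleO_natCast_iff.2 h3
  have e1 : (fun n : ℕ ↦ (∑ i ∈ Finset.range n, w i ^ 2) - σ ^ 2 * n) =o[atTop]
      (fun n : ℕ ↦ (n : ℝ)) := by
    refine isLittleO_natCast_iff.2 ?_
    have := h1.sub_const (σ ^ 2)
    rw [sub_self] at this
    refine this.congr' ((eventually_gt_atTop 0).mono fun n hn ↦ ?_)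
    have : (n : ℝ) ≠ 0 := by positivity
    field_simp
  -- three linear relations, up to `o(n)`, between the three sums; they are solved for `sumSq`
  -- first, then for `sumLagOne` and `sumLagTwo`
  set E := fun n ↦ (1 + θ * ρ) * sumLagOne x n - (θ + ρ) * sumSq x n with hE
  set F := fun n : ℕ ↦ (1 - (θ + ρ) ^ 2 - (θ * ρ) ^ 2) * sumSq x n
      + 2 * (θ + ρ) * (θ * ρ) * sumLagOne x n - σ ^ 2 * n with hF
  set G := fun n ↦ sumLagTwo x n - (θ + ρ) * sumLagOne x n + θ * ρ * sumSq x n with hG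
  have hEo : E =o[atTop] (fun n : ℕ ↦ (n : ℝ)) := by
    refine (e2.add ((((((hx.const_mul_left (θ + ρ)).add hxw).sub hxx).add (hc (x 1 * x 0))).sub
      (hc ((θ + ρ) * x 0 ^ 2))).sub (hc (x 0 * w 0)))).congr_left fun n ↦ ?_
    have := sumLagOne_recursion hrec n
    simp only [hE]
    linear_combination -this
  have hGo : G =o[atTop] (fun n : ℕ ↦ (n : ℝ)) := by
    refine e3.congr_left fun n ↦ ?_
    have := sumLagTwo_recursion hrec n
    simp only [hG]
    linear_combination -this
  have hFo : F =o[atTop] (fun n : ℕ ↦ (n : ℝ)) := by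
    refine ((((e2.const_mul_left (2 * (θ + ρ))).add (e3.const_mul_left (2 * -(θ * ρ)))).add e1).add
      (((((hx.const_mul_left ((θ + ρ) ^ 2)).sub hx).sub hx').add
        (hxw.const_mul_left (2 * (θ + ρ)))).add hw |>.add (hc (x 0 ^ 2 + x 1 ^ 2
          - (θ + ρ) ^ 2 * x 0 ^ 2 - 2 * (θ + ρ) * (x 0 * w 0) - w 0 ^ 2)))).congr_left fun n ↦ ?_
    have := sumSq_recursion hrec n
    simp only [hF]
    linear_combination -this
  have key : ∀ {f : ℕ → ℝ} {l : ℝ}, (fun n : ℕ ↦ f n - l * n) =o[atTop] (fun n : ℕ ↦ (n : ℝ)) →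
      Tendsto (fun n : ℕ ↦ f n / n) atTop (𝓝 l) := by
    intro f l h
    have := (isLittleO_natCast_iff.1 h).add_const l
    rw [zero_add] at this
    refine this.congr' ((eventually_gt_atTop 0).mono fun n hn ↦ ?_)
    have : (n : ℝ) ≠ 0 := by positivity
    field_simp
    ring
  set D := (1 - θ * ρ) * (1 - θ ^ 2) * (1 - ρ ^ 2) with hD
  have hD0 : D ≠ 0 := by positivity
  have hS : (fun n : ℕ ↦ sumSq x n - limVar θ ρ σ * n) =o[atTop] (fun n : ℕ ↦ (n : ℝ)) := by
    refine ((hFo.const_mul_left ((1 + θ * ρ) / D)).sub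
      (hEo.const_mul_left (2 * (θ + ρ) * (θ * ρ) / D))).congr_left fun n ↦ ?_
    simp only [hE, hF, limVar, ← hD]
    field_simp
    simp only [hD]
    ring
  have hA : (fun n : ℕ ↦ sumLagOne x n - limCorr θ ρ * limVar θ ρ σ * n) =o[atTop]
      (fun n : ℕ ↦ (n : ℝ)) := by
    refine ((hEo.const_mul_left (1 / (1 + θ * ρ))).add
      (hS.const_mul_left (limCorr θ ρ))).congr_left fun n ↦ ?_
    simp only [hE, limCorr]
    field_simp
    ring
  refine ⟨key hS, key hA, key ((hGo.add ((hA.const_mul_left (θ + ρ)).sub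
    (hS.const_mul_left (θ * ρ)))).congr_left fun n ↦ ?_)⟩
  simp only [hG]
  ring

/-! ### The Durbin-Watson statistic along a path -/

section Path

variable {Ω : Type*} {X : ℕ → Ω → ℝ} {ω : Ω}

lemma sum_Icc_one_eq_sum_range (f : ℕ → ℝ) (n : ℕ) :
    ∑ k ∈ Finset.Icc 1 n, f k = ∑ i ∈ Finset.range n, f (i + 1) := by
  induction n with
  | zero => simp
  | succ n ih => rw [Finset.sum_Icc_succ_top (by omega), ih, Finset.sum_range_succ]

lemma thetaHat_eq (X : ℕ → Ω → ℝ) (n : ℕ) (ω : Ω) :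
    thetaHat X n ω = sumLagOne (X · ω) n / sumSq (X · ω) n := by
  simp [thetaHat, sum_Icc_one_eq_sum_range, sumLagOne, sumSq]

lemma varthetaSqHat_succ (X : ℕ → Ω → ℝ) (n : ℕ) (ω : Ω) :
    varthetaSqHat X (n + 1) ω = sumLagTwo (X · ω) n / sumSq (X · ω) n := by
  have h : ∀ f : ℕ → ℝ, ∑ k ∈ Finset.Icc 2 (n + 1), f k = ∑ i ∈ Finset.range n, f (i + 2) := by
    intro f
    induction n with
    | zero => simp
    | succ n ih => rw [Finset.sum_Icc_succ_top (by omega), ih, Finset.sum_range_succ]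
  simp [varthetaSqHat, h, sumLagTwo, sumSq, mul_comm]

/-- The residual sum of squares `∑_{k=0}^n ε̂_k²`, in the form it takes when `∑_{i<n} x_i² ≠ 0`. -/
noncomputable def residSq (x : ℕ → ℝ) (n : ℕ) : ℝ :=
  sumSq x (n + 1) - sumLagOne x n / sumSq x n * sumLagOne x n

/-- The squares of the first and of the last residual. -/
noncomputable def residEnds (x : ℕ → ℝ) (n : ℕ) : ℝ :=
  x 0 ^ 2 + (x (n + 1) - sumLagOne x (n + 1) / sumSq x (n + 1) * x n) ^ 2

/-- Since `sumLagOne = θ̂ * sumSq`, the lag-one sum of the residuals factors as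
`θ̂ * (θ̂ * sumLagOne - sumLagTwo)`, the last two sums being one step shorter. -/
lemma dwStat_sub_two {n : ℕ} (hS : sumSq (X · ω) (n + 1) ≠ 0)
    (hJ : residSq (X · ω) (n + 1) ≠ 0) :
    dwStat X (n + 1) ω - 2 = -(2 * (sumLagOne (X · ω) (n + 1) / sumSq (X · ω) (n + 1)) *
      (sumLagOne (X · ω) (n + 1) / sumSq (X · ω) (n + 1) * sumLagOne (X · ω) n
        - sumLagTwo (X · ω) n) + residEnds (X · ω) n) / residSq (X · ω) (n + 1) := by
  set x : ℕ → ℝ := fun k ↦ X k ω with hx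
  set t := sumLagOne x (n + 1) / sumSq x (n + 1) with ht
  have htA : t * sumSq x (n + 1) = sumLagOne x (n + 1) := by rw [ht]; field_simp
  set e : ℕ → ℝ := fun k ↦ residual X (n + 1) k ω with he
  have e0 : e 0 = x 0 := by simp [he, residual, hx]
  have e1 : ∀ k, e (k + 1) = x (k + 1) - t * x k := by
    intro k; simp [he, residual, thetaHat_eq, ht, hx]
  have hdiff : ∀ m, ∑ k ∈ Finset.Icc 1 m, (e k - e (k - 1)) ^ 2 =
      2 * (∑ k ∈ Finset.Icc 0 m, e k ^ 2) - e 0 ^ 2 - e m ^ 2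
        - 2 * ∑ i ∈ Finset.range m, e (i + 1) * e i := by
    intro m
    induction m with
    | zero => simp; ring
    | succ m ih =>
      rw [Finset.sum_Icc_succ_top (by omega), Finset.sum_Icc_succ_top (by omega), ih,
        Finset.sum_range_succ, Nat.add_sub_cancel]
      ring
  have hlag : ∀ m, ∑ i ∈ Finset.range (m + 1), e (i + 1) * e i =
      sumLagOne x (m + 1) - t * sumLagTwo x m - t * sumSq x (m + 1) + t ^ 2 * sumLagOne x m := by
    intro m
    induction m with
    | zero => simp [sumLagOne, sumLagTwo, sumSq, e0, e1]; ring
    | succ m ih =>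
      rw [Finset.sum_range_succ, ih]
      simp only [sumLagOne, sumLagTwo, sumSq, Finset.sum_range_succ, e1]
      ring
  have hsq : ∀ m, ∑ k ∈ Finset.Icc 0 m, e k ^ 2 =
      sumSq x (m + 1) - 2 * t * sumLagOne x m + t ^ 2 * sumSq x m := by
    intro m
    induction m with
    | zero => simp [sumLagOne, sumSq, e0]
    | succ m ih =>
      rw [Finset.sum_Icc_succ_top (by omega), ih]
      simp only [sumLagOne, sumSq, Finset.sum_range_succ, e1]
      ring
  have hden : ∑ k ∈ Finset.Icc 0 (n + 1), e k ^ 2 = residSq x (n + 1) := by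
    rw [hsq, residSq, ← ht]
    linear_combination t * htA
  have hdw : dwStat X (n + 1) ω = (∑ k ∈ Finset.Icc 1 (n + 1), (e k - e (k - 1)) ^ 2) /
      ∑ k ∈ Finset.Icc 0 (n + 1), e k ^ 2 := rfl
  rw [hdw, hdiff, hden, hlag, e0, e1, residEnds, ← ht, div_sub' hJ]
  congr 1
  linear_combination 2 * htA

/-- Limits of normalized quadratic sums give the limits of the statistics. -/
lemma tendsto_statistics {s r q : ℝ} (hs : 0 < s) (hr : r ^ 2 < 1)
    (hx : (fun n ↦ X n ω ^ 2) =o[atTop] (fun n : ℕ ↦ (n : ℝ)))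
    (hS : Tendsto (fun n : ℕ ↦ sumSq (X · ω) n / n) atTop (𝓝 s))
    (hA : Tendsto (fun n : ℕ ↦ sumLagOne (X · ω) n / n) atTop (𝓝 (r * s)))
    (hQ : Tendsto (fun n : ℕ ↦ sumLagTwo (X · ω) n / n) atTop (𝓝 (q * s))) :
    Tendsto (fun n ↦ sumLagOne (X · ω) n / sumSq (X · ω) n) atTop (𝓝 r) ∧
    Tendsto (fun n ↦ varthetaSqHat X n ω) atTop (𝓝 q) ∧
    Tendsto (fun n : ℕ ↦ residSq (X · ω) n / n) atTop (𝓝 (s * (1 - r ^ 2))) ∧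
    (∀ᶠ n in atTop, sumSq (X · ω) n ≠ 0 ∧ residSq (X · ω) n ≠ 0) ∧
    Tendsto (fun n : ℕ ↦ (sumLagOne (X · ω) (n + 1) / sumSq (X · ω) (n + 1) * sumLagOne (X · ω) n
        - sumLagTwo (X · ω) n) / ((n + 1 : ℕ) : ℝ)) atTop (𝓝 ((r ^ 2 - q) * s)) := by
  set x : ℕ → ℝ := fun k ↦ X k ω with hxdef
  have hquot : ∀ {f g : ℕ → ℝ} {l : ℝ}, Tendsto (fun n : ℕ ↦ f n / n) atTop (𝓝 (l * s)) →
      Tendsto (fun n : ℕ ↦ g n / n) atTop (𝓝 s) → Tendsto (fun n ↦ f n / g n) atTop (𝓝 l) := by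
    intro f g l hf hg
    have := hf.div hg hs.ne'
    rw [mul_div_cancel_right₀ _ hs.ne'] at this
    refine this.congr' ((eventually_gt_atTop 0).mono fun n hn ↦ ?_)
    have : (n : ℝ) ≠ 0 := by positivity
    simp only [Pi.div_apply]
    field_simp
  have ht := hquot hA hS
  have hJ : Tendsto (fun n : ℕ ↦ residSq x n / n) atTop (𝓝 (s * (1 - r ^ 2))) := by
    have h := (hS.add (isLittleO_natCast_iff.1 hx)).sub (ht.mul hA)
    rw [show s + 0 - r * (r * s) = s * (1 - r ^ 2) by ring] at h
    refine h.congr fun n ↦ ?_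
    rw [residSq, show sumSq x (n + 1) = sumSq x n + x n ^ 2 by simp [sumSq, Finset.sum_range_succ]]
    ring
  have hne : ∀ {f : ℕ → ℝ} {l : ℝ}, 0 < l → Tendsto (fun n : ℕ ↦ f n / n) atTop (𝓝 l) →
      ∀ᶠ n in atTop, f n ≠ 0 := by
    intro f l hl h
    filter_upwards [h.eventually (lt_mem_nhds hl)] with n hn h0
    simp [h0] at hn
  have hshift : ∀ {f : ℕ → ℝ} {l : ℝ}, Tendsto (fun n : ℕ ↦ f n / n) atTop (𝓝 l) →
      Tendsto (fun n : ℕ ↦ f n / ((n + 1 : ℕ) : ℝ)) atTop (𝓝 l) := by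
    intro f l h
    have h' := h.mul (tendsto_natCast_div_add_atTop (1 : ℝ))
    rw [mul_one] at h'
    refine h'.congr' ((eventually_gt_atTop 0).mono fun n hn ↦ ?_)
    have : (n : ℝ) ≠ 0 := by positivity
    push_cast
    field_simp
  refine ⟨ht, (tendsto_add_atTop_iff_nat 1).1 ?_, hJ, (hne hs hS).and (hne ?_ hJ), ?_⟩
  · simpa only [varthetaSqHat_succ] using hquot hQ hS
  · exact mul_pos hs (by linarith)
  · have h := (((tendsto_add_atTop_iff_nat 1).2 ht).mul (hshift hA)).sub (hshift hQ)
    rw [show r * (r * s) - q * s = (r ^ 2 - q) * s by ring] at h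
    refine h.congr fun n ↦ ?_
    ring

lemma isLittleO_residEnds {x : ℕ → ℝ} {r : ℝ} {h : ℕ → ℝ}
    (ht : Tendsto (fun n ↦ sumLagOne x n / sumSq x n) atTop (𝓝 r))
    (hc : ∀ c : ℝ, (fun _ : ℕ ↦ c) =o[atTop] h)
    (hx : (fun n ↦ x n ^ 2) =o[atTop] h) (hx' : (fun n ↦ x (n + 1) ^ 2) =o[atTop] h) :
    residEnds x =o[atTop] h := by
  have hb := ((tendsto_add_atTop_iff_nat 1).2 ht).isBigO_one ℝ
  have hxx := isLittleO_mul_of_sq hx' hx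
  have h1 := hb.mul_isLittleO hxx
  have h2 := (hb.mul hb).mul_isLittleO hx
  simp only [one_mul] at h1 h2
  refine ((hc (x 0 ^ 2)).add ((hx'.sub (h1.const_mul_left 2)).add h2)).congr_left fun n ↦ ?_
  simp only [residEnds]
  ring

/-- If the limit `-2 * r * (r ^ 2 - q) / (1 - r ^ 2)` of `D̂ₙ - 2` is not zero, then the test
statistic diverges. -/
lemma tendsto_testStat_atTop {s r q : ℝ} (hs : 0 < s) (hr : r ^ 2 < 1)
    (hx : (fun n ↦ X n ω ^ 2) =o[atTop] (fun n : ℕ ↦ (n : ℝ)))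
    (hS : Tendsto (fun n : ℕ ↦ sumSq (X · ω) n / n) atTop (𝓝 s))
    (hA : Tendsto (fun n : ℕ ↦ sumLagOne (X · ω) n / n) atTop (𝓝 (r * s)))
    (hQ : Tendsto (fun n : ℕ ↦ sumLagTwo (X · ω) n / n) atTop (𝓝 (q * s)))
    (hr0 : r ≠ 0) (hq0 : 0 < q) (hq1 : q < 1) (hrq : r ^ 2 ≠ q) :
    Tendsto (fun n ↦ testStat X n ω) atTop atTop := by
  obtain ⟨ht, hv, hJ, hne, hN⟩ := tendsto_statistics hs hr hx hS hA hQ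
  have hr1 : 1 - r ^ 2 ≠ 0 := by linarith
  have hends := isLittleO_natCast_iff.1 (isLittleO_residEnds ht isLittleO_const_natCast hx
    (isLittleO_natCast_succ hx))
  have hends' : Tendsto (fun n : ℕ ↦ residEnds (X · ω) n / ((n + 1 : ℕ) : ℝ)) atTop (𝓝 0) := by
    have h' := hends.mul (tendsto_natCast_div_add_atTop (1 : ℝ))
    rw [zero_mul] at h'
    refine h'.congr' ((eventually_gt_atTop 0).mono fun n hn ↦ ?_)
    have : (n : ℝ) ≠ 0 := by positivity
    push_cast
    field_simp
  have hD : Tendsto (fun n ↦ dwStat X n ω - 2) atTop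
      (𝓝 (-(2 * r * ((r ^ 2 - q) * s) + 0) / (s * (1 - r ^ 2)))) := by
    refine (tendsto_add_atTop_iff_nat 1).1 ?_
    have h := ((((((tendsto_add_atTop_iff_nat 1).2 ht).const_mul 2).mul hN).add hends').neg).div
      ((tendsto_add_atTop_iff_nat 1).2 hJ) (by positivity)
    refine h.congr' (((tendsto_add_atTop_nat 1).eventually hne).mono fun n hn ↦ ?_)
    simp only [Pi.div_apply]
    rw [dwStat_sub_two hn.1 hn.2]
    have : ((n + 1 : ℕ) : ℝ) ≠ 0 := by positivity
    have := hn.2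
    field_simp
  set d := -(2 * r * ((r ^ 2 - q) * s) + 0) / (s * (1 - r ^ 2)) with hd
  have hd0 : d ≠ 0 := by
    rw [hd]
    have : r ^ 2 - q ≠ 0 := sub_ne_zero.2 hrq
    simp only [add_zero]
    exact div_ne_zero (neg_ne_zero.2 (by positivity)) (by positivity)
  have hG : Tendsto (fun n ↦ (1 - varthetaSqHat X n ω) / (4 * varthetaSqHat X n ω ^ 2 *
      (1 + varthetaSqHat X n ω)) * (dwStat X n ω - 2) ^ 2) atTop
      (𝓝 ((1 - q) / (4 * q ^ 2 * (1 + q)) * d ^ 2)) :=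
    ((hv.const_sub 1).div (((hv.pow 2).const_mul 4).mul (hv.const_add 1)) (by positivity)).mul
      (hD.pow 2)
  have hpos : 0 < (1 - q) / (4 * q ^ 2 * (1 + q)) * d ^ 2 := by
    have : 0 < 1 - q := by linarith
    positivity
  refine (tendsto_natCast_atTop_atTop.atTop_mul_pos hpos hG).congr fun n ↦ ?_
  rw [testStat]
  ring

/-- The factor of `∑ X_{k-1} V_k / √n` in `√n (D̂ₙ - 2)`, when `X_k = a X_{k-2} + V_k`. -/
noncomputable def leadCoeff (a : ℝ) (x : ℕ → ℝ) (n : ℕ) : ℝ :=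
  -2 * n * (sumLagOne x n / sumSq x n * sumLagOne x (n - 1) - sumLagTwo x (n - 1)) /
    ((1 - a) * sumSq x n * residSq x n)

/-- Linearization of the Durbin-Watson statistic of `X_k = a X_{k-2} + V_k`: up to a negligible
term, `√n (D̂ₙ - 2)` is a multiple of `m n / √n`, where `m n` approximates `∑ X_{k-1} V_k`. -/
lemma tendsto_linearization {a s : ℝ} {w m : ℕ → ℝ} (hs : 0 < s) (ha1 : a < 1)
    (hrec : ∀ k, X (k + 2) ω = a * X k ω + w (k + 1))
    (hx : (fun n ↦ X n ω ^ 2) =o[atTop] (fun n : ℕ ↦ √(n : ℝ)))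
    (hw : (fun n ↦ w n ^ 2) =o[atTop] (fun n : ℕ ↦ √(n : ℝ)))
    (hm : (fun n ↦ (∑ i ∈ Finset.range n, X i ω * w i) - m n) =o[atTop]
      (fun n : ℕ ↦ √(n : ℝ)))
    (hS : Tendsto (fun n : ℕ ↦ sumSq (X · ω) n / n) atTop (𝓝 s))
    (hA : Tendsto (fun n : ℕ ↦ sumLagOne (X · ω) n / n) atTop (𝓝 (0 * s)))
    (hQ : Tendsto (fun n : ℕ ↦ sumLagTwo (X · ω) n / n) atTop (𝓝 (a * s))) :
    Tendsto (leadCoeff a (X · ω)) atTop (𝓝 (2 * a / ((1 - a) * s))) ∧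
    Tendsto (fun n : ℕ ↦ √(n : ℝ) * (dwStat X n ω - 2)
      - leadCoeff a (X · ω) n * (m n / √(n : ℝ))) atTop (𝓝 0) := by
  have ha1' : 1 - a ≠ 0 := by linarith
  obtain ⟨ht, hv, hJ, hne, hN⟩ := tendsto_statistics hs (by norm_num)
    (hx.trans isLittleO_sqrt_natCast) hS hA hQ
  have hsucc : (fun n : ℕ ↦ √((n + 1 : ℕ) : ℝ)) =O[atTop] (fun n : ℕ ↦ √(n : ℝ)) := by
    refine IsBigO.of_bound 2 ((eventually_ge_atTop 1).mono fun n hn ↦ ?_)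
    rw [Real.norm_of_nonneg (by positivity), Real.norm_of_nonneg (by positivity)]
    rw [show (2 : ℝ) = √(2 ^ 2) by simp, ← Real.sqrt_mul (by positivity)]
    refine Real.sqrt_le_sqrt ?_
    have : (1 : ℝ) ≤ n := by exact_mod_cast hn
    push_cast; linarith
  have hx' : (fun n ↦ X (n + 1) ω ^ 2) =o[atTop] (fun n : ℕ ↦ √(n : ℝ)) :=
    (hx.comp_tendsto (tendsto_add_atTop_nat 1)).trans_isBigO hsucc
  have hc : ∀ c : ℝ, (fun _ : ℕ ↦ c) =o[atTop] (fun n : ℕ ↦ √(n : ℝ)) := fun c ↦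
    isLittleO_const_left.2 <| Or.inr <| tendsto_norm_atTop_atTop.comp <|
      Real.tendsto_sqrt_atTop.comp tendsto_natCast_atTop_atTop
  have hsqrt : ∀ {f : ℕ → ℝ}, f =o[atTop] (fun n : ℕ ↦ √(n : ℝ)) →
      Tendsto (fun n : ℕ ↦ f n / √(n : ℝ)) atTop (𝓝 0) := fun h ↦ h.tendsto_div_nhds_zero
  have hends : Tendsto (fun n : ℕ ↦ residEnds (X · ω) n / √((n + 1 : ℕ) : ℝ)) atTop (𝓝 0) := by
    refine ((isLittleO_residEnds ht hc hx hx').trans_isBigO ?_).tendsto_div_nhds_zero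
    refine IsBigO.of_bound 1 (Eventually.of_forall fun n ↦ ?_)
    rw [Real.norm_of_nonneg (by positivity), Real.norm_of_nonneg (by positivity), one_mul]
    exact Real.sqrt_le_sqrt (by push_cast; linarith)
  have hlead : Tendsto (leadCoeff a (X · ω)) atTop (𝓝 (2 * a / ((1 - a) * s))) := by
    refine (tendsto_add_atTop_iff_nat 1).1 ?_
    have h := (hN.const_mul (-2)).div
      ((((tendsto_add_atTop_iff_nat 1).2 hS).const_mul (1 - a)).mul
        ((tendsto_add_atTop_iff_nat 1).2 hJ)) (by simp [hs.ne', ha1'])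
    rw [show -2 * ((0 ^ 2 - a) * s) / ((1 - a) * s * (s * (1 - 0 ^ 2))) = 2 * a / ((1 - a) * s) by
      field_simp; ring] at h
    refine h.congr' (((tendsto_add_atTop_nat 1).eventually hne).mono fun n hn ↦ ?_)
    have h0 : ((n + 1 : ℕ) : ℝ) ≠ 0 := by positivity
    have h1 := hn.1
    have h2 := hn.2
    simp only [Pi.div_apply, leadCoeff, Nat.add_sub_cancel]
    field_simp
  refine ⟨hlead, ?_⟩
  -- as `θ̂ = sumLagOne / sumSq` is of order `1 / √n`, its numerator has to be known up to `o(√n)`;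
  -- `B` is the error made in replacing `(1 - a) * sumLagOne` by `m`
  set B : ℕ → ℝ := fun n ↦ (1 - a) * sumLagOne (X · ω) n - m n with hB
  have hBo : B =o[atTop] (fun n : ℕ ↦ √(n : ℝ)) := by
    refine (hm.add (((isLittleO_mul_of_sq hx hw).sub (isLittleO_mul_of_sq hx' hx)).add
      (hc (X 1 ω * X 0 ω - X 0 ω * w 0)))).congr_left fun n ↦ ?_
    have := sumLagOne_recursion (x := (X · ω)) (w := w) (a := 0) (b := a)
      (fun k ↦ by simpa using hrec k) n
    simp only [hB]
    linear_combination -this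
  refine (tendsto_add_atTop_iff_nat 1).1 ?_
  have h := (((tendsto_add_atTop_iff_nat 1).2 hlead).mul
    ((tendsto_add_atTop_iff_nat 1).2 (hsqrt hBo))).sub
    (hends.div ((tendsto_add_atTop_iff_nat 1).2 hJ) (by simp [hs.ne']))
  rw [mul_zero, zero_div, sub_zero] at h
  refine h.congr' (((tendsto_add_atTop_nat 1).eventually hne).mono fun n hn ↦ ?_)
  simp only [Pi.div_apply]
  rw [dwStat_sub_two hn.1 hn.2]
  have h0 : 0 < ((n + 1 : ℕ) : ℝ) := by positivity
  have h1 := hn.1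
  have h2 := hn.2
  have hq : 0 < √((n + 1 : ℕ) : ℝ) := Real.sqrt_pos.2 h0
  have hqq : ((n + 1 : ℕ) : ℝ) = √((n + 1 : ℕ) : ℝ) ^ 2 := (Real.sq_sqrt h0.le).symm
  simp only [leadCoeff, Nat.add_sub_cancel, hB]
  set z := √((n + 1 : ℕ) : ℝ)
  rw [hqq]
  field_simp
  ring

end Path

/-! ### Centered independent noise and predictable sums -/

section Noise

variable {Ω : Type*} [mΩ : MeasurableSpace Ω] {P : Measure Ω} {W : ℕ → Ω → ℝ} {σ : ℝ}

/-- `W 0, W 1, …` are independent and identically distributed, centered, of variance `σ ^ 2` and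
with a finite fourth moment. -/
structure IsNoise (W : ℕ → Ω → ℝ) (P : Measure Ω) (σ : ℝ) : Prop where
  measurable : ∀ i, Measurable (W i)
  indep : iIndepFun W P
  ident : ∀ i, IdentDistrib (W i) (W 0) P P
  integral_eq : ∫ ω, W 0 ω ∂P = 0
  integral_sq : ∫ ω, W 0 ω ^ 2 ∂P = σ ^ 2
  memLp : MemLp (W 0) 4 P

/-- The filtration whose `n`-th sigma-algebra is generated by `W 0, …, W (n - 1)`. -/
def past (W : ℕ → Ω → ℝ) (hW : ∀ i, Measurable (W i)) : Filtration ℕ mΩ where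
  seq n := ⨆ j ∈ Set.Iio n, MeasurableSpace.comap (W j) inferInstance
  mono' _ _ h := biSup_mono fun _ hj ↦ lt_of_lt_of_le hj h
  le' _ := iSup₂_le fun j _ ↦ (hW j).comap_le

lemma measurable_past (hW : ∀ i, Measurable (W i)) {i n : ℕ} (h : i < n) :
    Measurable[past W hW n] (W i) :=
  measurable_iff_comap_le.2 (le_iSup₂_of_le (f := fun j (_ : j ∈ Set.Iio n) ↦
    MeasurableSpace.comap (W j) inferInstance) i h le_rfl)

namespace IsNoise

lemma indep_past (h : IsNoise W P σ) {n j : ℕ} (hj : n ≤ j) :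
    Indep (past W h.measurable n) (MeasurableSpace.comap (W j) inferInstance) P := by
  have := indep_iSup_of_disjoint (fun i ↦ (h.measurable i).comap_le) h.indep
    (S := Set.Iio n) (T := {j}) (by simpa using hj)
  simp only [Set.mem_singleton_iff, iSup_iSup_eq_left] at this
  exact this

lemma indepFun {β : Type*} [MeasurableSpace β] (h : IsNoise W P σ) {n j : ℕ} (hj : n ≤ j)
    {f : Ω → β} (hf : Measurable[past W h.measurable n] f) : f ⟂ᵢ[P] W j :=
  (IndepFun_iff_Indep _ _ _).2 (indep_of_indep_of_le_left (h.indep_past hj) hf.comap_le)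

lemma measurable_of_past {β : Type*} [MeasurableSpace β] (h : IsNoise W P σ) {n : ℕ}
    {f : Ω → β} (hf : Measurable[past W h.measurable n] f) : Measurable f :=
  hf.mono ((past W h.measurable).le n) le_rfl

lemma memLp' (h : IsNoise W P σ) (i : ℕ) : MemLp (W i) 4 P := (h.ident i).memLp_iff.2 h.memLp

lemma memLp_two [IsProbabilityMeasure P] (h : IsNoise W P σ) (i : ℕ) : MemLp (W i) 2 P :=
  (h.memLp' i).mono_exponent (by norm_num)

lemma integrable [IsProbabilityMeasure P] (h : IsNoise W P σ) (i : ℕ) : Integrable (W i) P :=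
  (h.memLp_two i).integrable (by norm_num)

lemma integral_eq' (h : IsNoise W P σ) (i : ℕ) : ∫ ω, W i ω ∂P = 0 :=
  (h.ident i).integral_eq.trans h.integral_eq

lemma integral_pow (h : IsNoise W P σ) (i k : ℕ) :
    ∫ ω, W i ω ^ k ∂P = ∫ ω, W 0 ω ^ k ∂P :=
  ((h.ident i).comp (measurable_id.pow_const k)).integral_eq

lemma integral_sq' (h : IsNoise W P σ) (i : ℕ) : ∫ ω, W i ω ^ 2 ∂P = σ ^ 2 :=
  (h.integral_pow i 2).trans h.integral_sq

/-- A variable that depends only on the past is orthogonal to the next innovation. -/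
lemma integral_mul_eq_zero (h : IsNoise W P σ) {n j : ℕ} (hj : n ≤ j) {f : Ω → ℝ}
    (hf : Measurable[past W h.measurable n] f) : ∫ ω, f ω * W j ω ∂P = 0 := by
  rw [(h.indepFun hj hf).integral_fun_mul_eq_mul_integral
    (h.measurable_of_past hf).aestronglyMeasurable (h.measurable j).aestronglyMeasurable,
    h.integral_eq', mul_zero]

lemma integral_sq_mul_sq (h : IsNoise W P σ) {n j : ℕ} (hj : n ≤ j) {f : Ω → ℝ}
    (hf : Measurable[past W h.measurable n] f) :
    ∫ ω, (f ω * W j ω) ^ 2 ∂P = (∫ ω, f ω ^ 2 ∂P) * σ ^ 2 := by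
  have hi : (fun ω ↦ f ω ^ 2) ⟂ᵢ[P] (fun ω ↦ W j ω ^ 2) :=
    (h.indepFun hj hf).comp (measurable_id.pow_const 2) (measurable_id.pow_const 2)
  simp_rw [mul_pow]
  rw [hi.integral_fun_mul_eq_mul_integral
    ((h.measurable_of_past hf).pow_const 2).aestronglyMeasurable
    ((h.measurable j).pow_const 2).aestronglyMeasurable, h.integral_sq']

lemma memLp_two_mul [IsProbabilityMeasure P] (h : IsNoise W P σ) {n j : ℕ} (hj : n ≤ j)
    {f : Ω → ℝ} (hf : Measurable[past W h.measurable n] f) (hf2 : MemLp f 2 P) :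
    MemLp (fun ω ↦ f ω * W j ω) 2 P := by
  have hm := h.measurable_of_past hf
  refine (memLp_two_iff_integrable_sq (hm.mul (h.measurable j)).aestronglyMeasurable).2 ?_
  have := ((h.indepFun hj hf).comp (measurable_id.pow_const 2)
    (measurable_id.pow_const 2)).integrable_mul hf2.integrable_sq (h.memLp_two j).integrable_sq
  refine this.congr (Eventually.of_forall fun ω ↦ ?_)
  simp [mul_pow]

end IsNoise

/-- **Kronecker's lemma** for the weights `1 / (i + 1)`. -/
lemma tendsto_average_of_tendsto_weighted_sum {d : ℕ → ℝ} {c : ℝ}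
    (h : Tendsto (fun n ↦ ∑ i ∈ Finset.range n, d i / ((i : ℝ) + 1)) atTop (𝓝 c)) :
    Tendsto (fun n : ℕ ↦ (∑ i ∈ Finset.range n, d i) / n) atTop (𝓝 0) := by
  set z : ℕ → ℝ := fun n ↦ ∑ i ∈ Finset.range n, d i / ((i : ℝ) + 1) with hz
  have hsum : ∀ n : ℕ, ∑ i ∈ Finset.range n, d i = n * z n - ∑ i ∈ Finset.range n, z i := by
    intro n
    induction n with
    | zero => simp
    | succ n ih =>
      have hzn : z (n + 1) = z n + d n / ((n : ℝ) + 1) := Finset.sum_range_succ _ _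
      rw [Finset.sum_range_succ, ih, Finset.sum_range_succ, hzn]
      have : (n : ℝ) + 1 ≠ 0 := by positivity
      push_cast
      field_simp
      ring
  have h' := h.sub h.cesaro
  rw [sub_self] at h'
  refine h'.congr' ((eventually_gt_atTop 0).mono fun n hn ↦ ?_)
  have : (n : ℝ) ≠ 0 := by positivity
  simp only [hsum]
  field_simp

/-- Strong law of large numbers for the martingale `∑ H i * W i`, with `H` predictable and bounded
in `L²`: the martingale `∑ H i * W i / (i + 1)` is bounded in `L²`, hence converges. -/
lemma IsNoise.ae_tendsto_average [IsProbabilityMeasure P] (h : IsNoise W P σ) {H : ℕ → Ω → ℝ}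
    {C : ℝ} (hH : ∀ n, Measurable[past W h.measurable n] (H n)) (hH2 : ∀ n, MemLp (H n) 2 P)
    (hC : ∀ n, ∫ ω, H n ω ^ 2 ∂P ≤ C) :
    ∀ᵐ ω ∂P, Tendsto (fun n : ℕ ↦ (∑ i ∈ Finset.range n, H i ω * W i ω) / n) atTop (𝓝 0) := by
  set Z : ℕ → Ω → ℝ := fun n ω ↦ ∑ i ∈ Finset.range n, H i ω * W i ω / ((i : ℝ) + 1) with hZ
  have hC0 : 0 ≤ C := (integral_nonneg fun ω ↦ sq_nonneg (H 0 ω)).trans (hC 0)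
  have hsucc : ∀ n ω, Z (n + 1) ω = Z n ω + H n ω * W n ω / ((n : ℝ) + 1) :=
    fun n ω ↦ Finset.sum_range_succ _ _
  have hZm : ∀ n, Measurable[past W h.measurable n] (Z n) := by
    intro n
    refine Finset.measurable_sum _ fun i hi ↦ ?_
    have hi' : i < n := Finset.mem_range.1 hi
    exact (((hH i).mono ((past W h.measurable).mono hi'.le) le_rfl).mul
      (measurable_past h.measurable hi')).div_const _
  have hHW : ∀ n, MemLp (fun ω ↦ H n ω * W n ω) 2 P := fun n ↦
    h.memLp_two_mul le_rfl (hH n) (hH2 n)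
  have hZ2 : ∀ n, MemLp (Z n) 2 P := fun n ↦
    memLp_finsetSum _ fun i _ ↦ by simpa only [div_eq_mul_inv] using (hHW i).mul_const _
  have hZi : ∀ n, Integrable (Z n) P := fun n ↦ (hZ2 n).integrable (by norm_num)
  have hmart : Martingale Z (past W h.measurable) P := by
    refine martingale_of_condExp_sub_eq_zero_nat (fun n ↦ (hZm n).stronglyMeasurable) hZi
      fun n ↦ ?_
    have heq : Z (n + 1) - Z n = (fun ω ↦ H n ω / ((n : ℝ) + 1)) * W n := by
      ext ω; simp only [Pi.sub_apply, Pi.mul_apply, hsucc]; ring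
    rw [heq]
    have h1 := condExp_mul_of_stronglyMeasurable_left (μ := P)
      (((hH n).div_const ((n : ℝ) + 1)).stronglyMeasurable) (g := W n)
      (heq ▸ (hZi (n + 1)).sub (hZi n)) (h.integrable n)
    have h2 := condExp_indep_eq (h.measurable n).comap_le ((past W h.measurable).le n)
      (comap_measurable (W n)).stronglyMeasurable (h.indep_past (le_refl n)).symm
    filter_upwards [h1, h2] with ω e1 e2
    rw [e1, Pi.mul_apply, e2, h.integral_eq']
    simp
  -- orthogonality of the increments bounds the second moments
  have hsq : ∀ n, ∫ ω, Z n ω ^ 2 ∂P ≤ C * σ ^ 2 * ∑ i ∈ Finset.range n, 1 / ((i : ℝ) + 1) ^ 2 := by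
    intro n
    induction n with
    | zero => simp [hZ]
    | succ n ih =>
      have i1 := (hZ2 n).integrable_sq
      have i2 : Integrable (fun ω ↦ 2 / ((n : ℝ) + 1) * (Z n ω * H n ω * W n ω)) P := by
        refine (((hZ2 n).integrable_mul (hHW n)).const_mul (2 / ((n : ℝ) + 1))).congr
          (Eventually.of_forall fun ω ↦ ?_)
        simp only [Pi.mul_apply]
        ring
      have i3 : Integrable (fun ω ↦ 1 / ((n : ℝ) + 1) ^ 2 * (H n ω * W n ω) ^ 2) P :=
        (hHW n).integrable_sq.const_mul _
      have i12 : Integrable (fun ω ↦ Z n ω ^ 2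
          + 2 / ((n : ℝ) + 1) * (Z n ω * H n ω * W n ω)) P := i1.add i2
      have e : ∀ ω, Z (n + 1) ω ^ 2 = Z n ω ^ 2 + 2 / ((n : ℝ) + 1) * (Z n ω * H n ω * W n ω)
          + 1 / ((n : ℝ) + 1) ^ 2 * (H n ω * W n ω) ^ 2 := by
        intro ω; rw [hsucc]; field_simp; ring
      simp_rw [e]
      rw [integral_add i12 i3, integral_add i1 i2, integral_const_mul, integral_const_mul,
        h.integral_mul_eq_zero (f := fun ω ↦ Z n ω * H n ω) le_rfl ((hZm n).mul (hH n)),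
        h.integral_sq_mul_sq le_rfl (hH n),
        Finset.sum_range_succ]
      have : 1 / ((n : ℝ) + 1) ^ 2 * ((∫ ω, H n ω ^ 2 ∂P) * σ ^ 2)
          ≤ 1 / ((n : ℝ) + 1) ^ 2 * (C * σ ^ 2) := by
        gcongr; exact hC n
      linarith
  have hsummable : Summable fun i : ℕ ↦ 1 / ((i : ℝ) + 1) ^ 2 := by
    simpa using (summable_nat_add_iff 1).2 (Real.summable_one_div_nat_pow.2 one_lt_two)
  set R : ℝ := 1 + C * σ ^ 2 * ∑' i : ℕ, 1 / ((i : ℝ) + 1) ^ 2 with hR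
  have hbdd : ∀ n, eLpNorm (Z n) 1 P ≤ (R.toNNReal : ENNReal) := by
    intro n
    rw [eLpNorm_one_eq_lintegral_enorm, ← ofReal_integral_norm_eq_lintegral_enorm (hZi n)]
    refine ENNReal.ofReal_le_ofReal ?_
    calc ∫ ω, ‖Z n ω‖ ∂P ≤ ∫ ω, (1 + Z n ω ^ 2) ∂P := by
          refine integral_mono (hZi n).norm ((integrable_const 1).add (hZ2 n).integrable_sq)
            fun ω ↦ ?_
          simp only [Real.norm_eq_abs]
          nlinarith [sq_abs (Z n ω), sq_nonneg (|Z n ω| - 1)]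
      _ = 1 + ∫ ω, Z n ω ^ 2 ∂P := by
          rw [integral_add (integrable_const 1) (hZ2 n).integrable_sq]; simp
      _ ≤ R := by
          have := hsummable.sum_le_tsum (Finset.range n) fun i _ ↦ by positivity
          have h0 : 0 ≤ C * σ ^ 2 := by positivity
          have := hsq n
          rw [hR]
          nlinarith
  filter_upwards [hmart.submartingale.exists_ae_tendsto_of_bdd hbdd] with ω ⟨c, hc⟩
  exact tendsto_average_of_tendsto_weighted_sum hc

/-! ### Moments of autoregressive processes started at zero -/

/-- The autoregressive recursion `x_{n+1} = a x_n + u_n` started at `x_0 = 0`. -/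
def arZero (a : ℝ) (u : ℕ → ℝ) : ℕ → ℝ
  | 0 => 0
  | n + 1 => a * arZero a u n + u n

lemma arZero_succ (a : ℝ) (u : ℕ → ℝ) (n : ℕ) : arZero a u (n + 1) = a * arZero a u n + u n := rfl

lemma IsNoise.measurable_arZero (h : IsNoise W P σ) (a : ℝ) {u : ℕ → Ω → ℝ}
    (hu : ∀ n, Measurable[past W h.measurable (n + 1)] (u n)) (n : ℕ) :
    Measurable[past W h.measurable n] fun ω ↦ arZero a (u · ω) n := by
  induction n with
  | zero => exact measurable_const
  | succ n ih =>
    exact ((ih.mono ((past W h.measurable).mono n.le_succ) le_rfl).const_mul a).add (hu n)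

lemma integrable_pow_four {f : Ω → ℝ} (hf : MemLp f 4 P) : Integrable (fun ω ↦ f ω ^ 4) P := by
  have := hf.integrable_norm_pow (p := 4) (by norm_num)
  refine this.congr (Eventually.of_forall fun ω ↦ ?_)
  simp only [Real.norm_eq_abs]
  exact (show Even 4 by decide).pow_abs _

lemma memLp_arZero [IsProbabilityMeasure P] (a : ℝ) {u : ℕ → Ω → ℝ} (hu : ∀ n, MemLp (u n) 4 P)
    (n : ℕ) : MemLp (fun ω ↦ arZero a (u · ω) n) 4 P := by
  induction n with
  | zero => exact memLp_const 0
  | succ n ih => exact (ih.const_mul a).add (hu n)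

lemma integral_arZero_pow_four_le [IsProbabilityMeasure P] {a C : ℝ} (ha : |a| < 1)
    {u : ℕ → Ω → ℝ} (hu : ∀ n, MemLp (u n) 4 P) (hC : ∀ n, ∫ ω, u n ω ^ 4 ∂P ≤ C) (n : ℕ) :
    ∫ ω, arZero a (u · ω) n ^ 4 ∂P ≤ C / (1 - |a|) ^ 4 := by
  have hb : 0 < 1 - |a| := by linarith
  have hC0 : 0 ≤ C := (integral_nonneg fun ω ↦ by positivity).trans (hC 0)
  induction n with
  | zero => simp [arZero]; positivity
  | succ n ih =>
    have i1 := integrable_pow_four (memLp_arZero a hu n)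
    have i2 := integrable_pow_four (hu n)
    calc ∫ ω, arZero a (u · ω) (n + 1) ^ 4 ∂P
        ≤ ∫ ω, (|a| * arZero a (u · ω) n ^ 4 + u n ω ^ 4 / (1 - |a|) ^ 3) ∂P :=
          integral_mono (integrable_pow_four (memLp_arZero a hu (n + 1)))
            ((i1.const_mul _).add (i2.div_const _)) fun ω ↦ mul_add_pow_four_le ha _ _
      _ = |a| * (∫ ω, arZero a (u · ω) n ^ 4 ∂P) + (∫ ω, u n ω ^ 4 ∂P) / (1 - |a|) ^ 3 := by
          rw [integral_add (i1.const_mul _) (i2.div_const _), integral_const_mul, integral_div]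
      _ ≤ |a| * (C / (1 - |a|) ^ 4) + C / (1 - |a|) ^ 3 := by
          gcongr; exact hC n
      _ = C / (1 - |a|) ^ 4 := by field_simp; ring

/-- The second order process driven by the innovations `w`, with zero initial values. -/
def arTwoZero (θ ρ : ℝ) (w : ℕ → ℝ) : ℕ → ℝ := arZero θ fun n ↦ arZero ρ w (n + 1)

lemma arTwoZero_recursion (θ ρ : ℝ) (w : ℕ → ℝ) (n : ℕ) : arTwoZero θ ρ w (n + 2) =
    (θ + ρ) * arTwoZero θ ρ w (n + 1) + -(θ * ρ) * arTwoZero θ ρ w n + w (n + 1) := by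
  simp only [arTwoZero, arZero_succ]
  ring

lemma IsNoise.measurable_arTwoZero (h : IsNoise W P σ) (θ ρ : ℝ) (n : ℕ) :
    Measurable[past W h.measurable n] fun ω ↦ arTwoZero θ ρ (W · ω) n :=
  h.measurable_arZero θ (u := fun n ω ↦ arZero ρ (W · ω) (n + 1))
    (fun n ↦ h.measurable_arZero ρ (fun n ↦ measurable_past _ n.lt_succ_self) (n + 1)) n

lemma IsNoise.memLp_arTwoZero [IsProbabilityMeasure P] (h : IsNoise W P σ) (θ ρ : ℝ) (n : ℕ) :
    MemLp (fun ω ↦ arTwoZero θ ρ (W · ω) n) 4 P :=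
  memLp_arZero θ (u := fun n ω ↦ arZero ρ (W · ω) (n + 1))
    (fun n ↦ memLp_arZero ρ h.memLp' (n + 1)) n

lemma IsNoise.exists_integral_arTwoZero_pow_four_le [IsProbabilityMeasure P] (h : IsNoise W P σ)
    {θ ρ : ℝ} (hθ : |θ| < 1) (hρ : |ρ| < 1) :
    ∃ C, ∀ n, ∫ ω, arTwoZero θ ρ (W · ω) n ^ 4 ∂P ≤ C :=
  ⟨_, integral_arZero_pow_four_le hθ (u := fun n ω ↦ arZero ρ (W · ω) (n + 1))
    (fun n ↦ memLp_arZero ρ h.memLp' (n + 1))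
    (fun n ↦ integral_arZero_pow_four_le hρ h.memLp' (fun i ↦ (h.integral_pow i 4).le) (n + 1))⟩

end Noise

/-! ### The central limit theorem -/

lemma norm_exp_mul_I_sub_taylor_le (x : ℝ) :
    ‖Complex.exp (x * Complex.I) - (1 + x * Complex.I - x ^ 2 / 2)‖ ≤ 4 * |x| ^ 3 := by
  rcases le_or_gt |x| 1 with hx | hx
  · have h := Complex.exp_bound' (x := x * Complex.I) (n := 3) (by simp; linarith)
    simp only [Finset.sum_range_succ, Finset.sum_range_zero, Nat.factorial] at h
    norm_num [mul_pow] at h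
    have e : (1 + x * Complex.I - (x : ℂ) ^ 2 / 2) = 1 + x * Complex.I + -(x : ℂ) ^ 2 / 2 := by ring
    rw [e]
    refine h.trans ?_
    have : 0 ≤ |x| ^ 3 := by positivity
    linarith
  · have h1 : ‖Complex.exp (x * Complex.I)‖ = 1 := Complex.norm_exp_ofReal_mul_I x
    have h2 : ‖(1 + x * Complex.I - (x : ℂ) ^ 2 / 2)‖ ≤ 1 + |x| + |x| ^ 2 / 2 := by
      refine (norm_sub_le _ _).trans (add_le_add ((norm_add_le _ _).trans ?_) ?_) <;> simp
    refine (norm_sub_le _ _).trans ?_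
    rw [h1]
    nlinarith [mul_pos (sub_pos.2 hx) (sub_pos.2 hx), mul_pos (mul_pos (sub_pos.2 hx)
      (sub_pos.2 hx)) (sub_pos.2 hx)]

lemma norm_exp_mul_I_sub_exp_mul_I_le (x y : ℝ) :
    ‖Complex.exp (x * Complex.I) - Complex.exp (y * Complex.I)‖ ≤ |x - y| := by
  have e : Complex.exp (x * Complex.I) - Complex.exp (y * Complex.I) =
      Complex.exp (y * Complex.I) * (Complex.exp (Complex.I * (x - y : ℝ)) - 1) := by
    rw [mul_sub, ← Complex.exp_add]; push_cast; ring_nf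
  rw [e, norm_mul, Complex.norm_exp_ofReal_mul_I, one_mul]
  exact Real.norm_exp_I_mul_ofReal_sub_one_le

/-- Summing a two-step contraction with constant error. -/
lemma sum_le_of_two_step_contraction {A : ℕ → ℝ} {q c B : ℝ} (hA : ∀ k, 0 ≤ A k)
    (hB : ∀ k, A k ≤ B) (h : ∀ k, A (k + 2) ≤ q * A k + c) (n : ℕ) :
    (1 - q) * ∑ k ∈ Finset.range n, A k ≤ 2 * B + n * c := by
  have h1 : ∑ k ∈ Finset.range n, A k ≤ ∑ k ∈ Finset.range (n + 2), A k :=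
    Finset.sum_le_sum_of_subset_of_nonneg (Finset.range_mono (by omega)) fun k _ _ ↦ hA k
  have h2 : ∑ k ∈ Finset.range (n + 2), A k = (∑ k ∈ Finset.range n, A (k + 2)) + A 1 + A 0 := by
    rw [Finset.sum_range_succ', Finset.sum_range_succ']
  have h3 : ∑ k ∈ Finset.range n, A (k + 2) ≤ q * (∑ k ∈ Finset.range n, A k) + n * c := by
    refine (Finset.sum_le_sum fun k _ ↦ h k).trans (le_of_eq ?_)
    simp [Finset.sum_add_distrib, Finset.mul_sum]
  linarith [hB 0, hB 1]

/-- Iterating an approximate linear recursion. -/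
lemma norm_sub_pow_le_sum {φ : ℕ → ℂ} {l : ℝ} {r : ℕ → ℝ} (h0 : φ 0 = 1) (hl : |1 - l| ≤ 1)
    (h : ∀ k, ‖φ (k + 1) - (1 - l) * φ k‖ ≤ r k) (n : ℕ) :
    ‖φ n - (1 - l) ^ n‖ ≤ ∑ k ∈ Finset.range n, r k := by
  induction n with
  | zero => simp [h0]
  | succ n ih =>
    have hl' : ‖(1 - l : ℂ)‖ ≤ 1 := by
      rw [← Complex.ofReal_one, ← Complex.ofReal_sub, Complex.norm_real]; exact hl
    rw [Finset.sum_range_succ]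
    calc ‖φ (n + 1) - (1 - l) ^ (n + 1)‖
        = ‖(1 - l) * (φ n - (1 - l) ^ n) + (φ (n + 1) - (1 - l) * φ n)‖ := by ring_nf
      _ ≤ ‖(1 - l : ℂ)‖ * ‖φ n - (1 - l) ^ n‖ + ‖φ (n + 1) - (1 - l) * φ n‖ :=
          (norm_add_le _ _).trans (by rw [norm_mul])
      _ ≤ 1 * ‖φ n - (1 - l) ^ n‖ + r n := by gcongr; exact h n
      _ ≤ _ := by rw [one_mul]; gcongr

/-- The martingale `∑_{i<n} y_i W_i`. -/
def martSum {Ω : Type*} (y W : ℕ → Ω → ℝ) (n : ℕ) (ω : Ω) : ℝ := ∑ i ∈ Finset.range n, y i ω * W i ω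

/-- The random phase whose expectation is the characteristic function of `martSum y W n`. -/
noncomputable def phase {Ω : Type*} (y W : ℕ → Ω → ℝ) (t : ℝ) (n : ℕ) (ω : Ω) : ℂ :=
  Complex.exp ((t * martSum y W n ω : ℝ) * Complex.I)

lemma norm_phase {Ω : Type*} (y W : ℕ → Ω → ℝ) (t : ℝ) (n : ℕ) (ω : Ω) : ‖phase y W t n ω‖ = 1 :=
  Complex.norm_exp_ofReal_mul_I _

section CentralLimit

variable {Ω : Type*} [mΩ : MeasurableSpace Ω] {P : Measure Ω} {W : ℕ → Ω → ℝ} {σ : ℝ}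

lemma IsNoise.integral_mul_pow (h : IsNoise W P σ) {n j : ℕ} (hj : n ≤ j) {f : Ω → ℂ}
    (hf : Measurable[past W h.measurable n] f) (k : ℕ) :
    ∫ ω, f ω * ((W j ω ^ k : ℝ) : ℂ) ∂P = (∫ ω, f ω ∂P) * ((∫ ω, W 0 ω ^ k ∂P : ℝ) : ℂ) := by
  have hm : Measurable fun x : ℝ ↦ ((x ^ k : ℝ) : ℂ) := by fun_prop
  have hi : f ⟂ᵢ[P] (fun ω ↦ ((W j ω ^ k : ℝ) : ℂ)) :=
    (h.indepFun hj hf).comp measurable_id hm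
  rw [hi.integral_fun_mul_eq_mul_integral (h.measurable_of_past hf).aestronglyMeasurable
    (hm.comp (h.measurable j)).aestronglyMeasurable, integral_complex_ofReal, h.integral_pow]

variable {y : ℕ → Ω → ℝ}

lemma IsNoise.measurable_martSum (h : IsNoise W P σ)
    (hy : ∀ n, Measurable[past W h.measurable n] (y n)) (n : ℕ) :
    Measurable[past W h.measurable n] (martSum y W n) := by
  refine Finset.measurable_sum _ fun i hi ↦ ?_
  have hi' : i < n := Finset.mem_range.1 hi
  exact ((hy i).mono ((past W h.measurable).mono hi'.le) le_rfl).mul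
    (measurable_past h.measurable hi')

lemma IsNoise.measurable_phase (h : IsNoise W P σ)
    (hy : ∀ n, Measurable[past W h.measurable n] (y n)) (t : ℝ) (n : ℕ) :
    Measurable[past W h.measurable n] (phase y W t n) := by
  have : Measurable fun x : ℝ ↦ Complex.exp ((t * x : ℝ) * Complex.I) := by fun_prop
  exact this.comp (h.measurable_martSum hy n)

lemma IsNoise.integrable_phase_mul (h : IsNoise W P σ)
    (hy : ∀ n, Measurable[past W h.measurable n] (y n)) (t : ℝ) (n : ℕ) {g : Ω → ℝ}
    (hg : Integrable g P) : Integrable (fun ω ↦ phase y W t n ω * (g ω : ℂ)) P :=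
  hg.ofReal.bdd_mul (c := 1) (h.measurable_of_past (h.measurable_phase hy t n)).aestronglyMeasurable
    (Eventually.of_forall fun ω ↦ (norm_phase y W t n ω).le)

variable [IsProbabilityMeasure P] {a C s : ℝ}

/-- The correlation between the phase and the centered conditional variance nearly contracts: the
phase moves by `O(t)` in two steps, while `y_{k+2}² - s` regresses to `a² (y_k² - s)`. -/
lemma IsNoise.norm_integral_phase_mul_contraction (h : IsNoise W P σ)
    (hy : ∀ n, Measurable[past W h.measurable n] (y n)) (hy4 : ∀ n, MemLp (y n) 4 P)
    (hC : ∀ n, ∫ ω, y n ω ^ 4 ∂P ≤ C) (hrec : ∀ n ω, y (n + 2) ω = a * y n ω + W (n + 1) ω)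
    (hs : s = a ^ 2 * s + σ ^ 2) (t : ℝ) (k : ℕ) :
    ‖∫ ω, phase y W t (k + 2) ω * ((y (k + 2) ω ^ 2 - s : ℝ) : ℂ) ∂P‖ ≤
      a ^ 2 * ‖∫ ω, phase y W t k ω * ((y k ω ^ 2 - s : ℝ) : ℂ) ∂P‖
        + |t| * (3 * C + 2 * (∫ ω, W 0 ω ^ 4 ∂P) + s ^ 2) := by
  have hy2 : ∀ n, Integrable (fun ω ↦ y n ω ^ 2) P := fun n ↦
    ((hy4 n).mono_exponent (p := 2) (by norm_num)).integrable_sq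
  have hys : ∀ n, Integrable (fun ω ↦ y n ω ^ 2 - s) P := fun n ↦
    (hy2 n).sub (integrable_const s)
  have i4 : ∀ n, Integrable (fun ω ↦ y n ω ^ 4) P := fun n ↦ integrable_pow_four (hy4 n)
  have iW4 : ∀ n, Integrable (fun ω ↦ W n ω ^ 4) P := fun n ↦ integrable_pow_four (h.memLp' n)
  have hyW : Integrable (fun ω ↦ y k ω * W (k + 1) ω) P :=
    (h.memLp_two_mul k.le_succ (hy k) ((hy4 k).mono_exponent (by norm_num))).integrable
      (by norm_num)
  -- replacing the phase at time `k + 2` by the phase at time `k`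
  have hdiff : ‖∫ ω, (phase y W t (k + 2) ω * ((y (k + 2) ω ^ 2 - s : ℝ) : ℂ)
      - phase y W t k ω * ((y (k + 2) ω ^ 2 - s : ℝ) : ℂ)) ∂P‖
      ≤ |t| * (3 * C + 2 * (∫ ω, W 0 ω ^ 4 ∂P) + s ^ 2) := by
    have ib : Integrable (fun ω ↦ y k ω ^ 4 + W k ω ^ 4 + y (k + 1) ω ^ 4 + W (k + 1) ω ^ 4
        + y (k + 2) ω ^ 4 + s ^ 2) P :=
      (((((i4 k).add (iW4 k)).add (i4 (k + 1))).add (iW4 (k + 1))).add (i4 (k + 2))).add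
        (integrable_const _)
    refine (norm_integral_le_of_norm_le (ib.const_mul |t|)
      (Eventually.of_forall fun ω ↦ ?_)).trans ?_
    · rw [← sub_mul, norm_mul, Complex.norm_real, Real.norm_eq_abs]
      have e1 : ‖phase y W t (k + 2) ω - phase y W t k ω‖ ≤
          |t| * |y k ω * W k ω + y (k + 1) ω * W (k + 1) ω| := by
        refine (norm_exp_mul_I_sub_exp_mul_I_le _ _).trans (le_of_eq ?_)
        rw [← abs_mul]
        congr 1
        simp only [martSum, Finset.sum_range_succ]
        ring
      have e2 : ∀ p q z : ℝ, |p + q| * |z ^ 2 - s| ≤ p ^ 2 + q ^ 2 + z ^ 4 + s ^ 2 := by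
        intro p q z
        nlinarith [sq_nonneg (|p + q| - |z ^ 2 - s|), sq_abs (p + q), sq_abs (z ^ 2 - s),
          sq_nonneg (p - q), sq_nonneg (z ^ 2 + s)]
      have e3 : ∀ p q : ℝ, (p * q) ^ 2 ≤ p ^ 4 + q ^ 4 := by
        intro p q
        nlinarith [sq_nonneg (p ^ 2 - q ^ 2), sq_nonneg (p ^ 2), sq_nonneg (q ^ 2)]
      calc _ ≤ |t| * |y k ω * W k ω + y (k + 1) ω * W (k + 1) ω| * |y (k + 2) ω ^ 2 - s| := by
            gcongr
        _ = |t| * (|y k ω * W k ω + y (k + 1) ω * W (k + 1) ω| * |y (k + 2) ω ^ 2 - s|) := by ring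
        _ ≤ _ := by
            gcongr
            refine (e2 _ _ _).trans ?_
            linarith [e3 (y k ω) (W k ω), e3 (y (k + 1) ω) (W (k + 1) ω)]
    · rw [integral_const_mul]
      gcongr
      have e : ∫ ω, (y k ω ^ 4 + W k ω ^ 4 + y (k + 1) ω ^ 4 + W (k + 1) ω ^ 4
          + y (k + 2) ω ^ 4 + s ^ 2) ∂P = (∫ ω, y k ω ^ 4 ∂P) + (∫ ω, W k ω ^ 4 ∂P)
          + (∫ ω, y (k + 1) ω ^ 4 ∂P) + (∫ ω, W (k + 1) ω ^ 4 ∂P)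
          + (∫ ω, y (k + 2) ω ^ 4 ∂P) + s ^ 2 := by
        have j2 := (i4 k).add (iW4 k)
        have j3 := j2.add (i4 (k + 1))
        have j4 := j3.add (iW4 (k + 1))
        have j5 := j4.add (i4 (k + 2))
        simp only [Pi.add_def] at j2 j3 j4 j5
        rw [integral_add j5 (integrable_const _), integral_add j4 (i4 _), integral_add j3 (iW4 _),
          integral_add j2 (i4 _), integral_add (i4 _) (iW4 _)]
        simp
      rw [e, h.integral_pow k, h.integral_pow (k + 1)]
      linarith [hC k, hC (k + 1), hC (k + 2)]
  -- regression of `y_{k+2}² - s` on the past: the terms in `W (k + 1)` integrate to zero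
  have hreg : ∫ ω, phase y W t k ω * ((y (k + 2) ω ^ 2 - s : ℝ) : ℂ) ∂P =
      (a ^ 2 : ℝ) * ∫ ω, phase y W t k ω * ((y k ω ^ 2 - s : ℝ) : ℂ) ∂P := by
    have hph := h.measurable_phase hy t k
    have z1 := h.integral_mul_pow k.le_succ
      (f := fun ω ↦ phase y W t k ω * (y k ω : ℂ))
      (hph.mul (Complex.measurable_ofReal.comp (hy k))) 1
    have z2 := h.integral_mul_pow k.le_succ hph 2
    simp only [pow_one] at z1
    rw [h.integral_eq, Complex.ofReal_zero, mul_zero] at z1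
    rw [h.integral_sq] at z2
    have j1 := (h.integrable_phase_mul hy t k (hys k)).const_mul ((a ^ 2 : ℝ) : ℂ)
    have j2 := (h.integrable_phase_mul hy t k hyW).const_mul ((2 * a : ℝ) : ℂ)
    have j3 := h.integrable_phase_mul hy t k (h.memLp_two (k + 1)).integrable_sq
    have j4 := h.integrable_phase_mul hy t k (integrable_const (σ ^ 2))
    have j12 := j1.add j2
    have j34 := j3.sub j4
    simp only [Pi.add_def, Pi.sub_def] at j12 j34
    have e : ∀ ω, phase y W t k ω * ((y (k + 2) ω ^ 2 - s : ℝ) : ℂ) =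
        ((a ^ 2 : ℝ) : ℂ) * (phase y W t k ω * ((y k ω ^ 2 - s : ℝ) : ℂ))
        + ((2 * a : ℝ) : ℂ) * (phase y W t k ω * ((y k ω * W (k + 1) ω : ℝ) : ℂ))
        + (phase y W t k ω * ((W (k + 1) ω ^ 2 : ℝ) : ℂ)
          - phase y W t k ω * ((σ ^ 2 : ℝ) : ℂ)) := by
      intro ω
      have : y (k + 2) ω ^ 2 - s = a ^ 2 * (y k ω ^ 2 - s) + 2 * a * (y k ω * W (k + 1) ω)
          + (W (k + 1) ω ^ 2 - σ ^ 2) := by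
        rw [hrec]; linear_combination -hs
      rw [this]; push_cast; ring
    simp_rw [e]
    rw [integral_add j12 j34, integral_add j1 j2, integral_sub j3 j4, z2, integral_mul_const,
      integral_const_mul, integral_const_mul]
    have z1' : ∫ ω, phase y W t k ω * ((y k ω * W (k + 1) ω : ℝ) : ℂ) ∂P = 0 := by
      rw [← z1]
      refine integral_congr_ae (Eventually.of_forall fun ω ↦ ?_)
      push_cast; ring
    rw [z1']
    ring
  rw [integral_sub (h.integrable_phase_mul hy t (k + 2) (hys (k + 2)))
    (h.integrable_phase_mul hy t k (hys (k + 2))), hreg] at hdiff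
  set A := ∫ ω, phase y W t k ω * ((y k ω ^ 2 - s : ℝ) : ℂ) ∂P
  set A' := ∫ ω, phase y W t (k + 2) ω * ((y (k + 2) ω ^ 2 - s : ℝ) : ℂ) ∂P
  have hn : ‖((a ^ 2 : ℝ) : ℂ) * A‖ = a ^ 2 * ‖A‖ := by
    rw [norm_mul, Complex.norm_real, Real.norm_of_nonneg (sq_nonneg a)]
  have := norm_sub_norm_le A' (((a ^ 2 : ℝ) : ℂ) * A)
  linarith

/-- One step of the recursion for the characteristic function, by a second order Taylor
expansion. -/
lemma IsNoise.norm_integral_phase_succ_le (h : IsNoise W P σ)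
    (hy : ∀ n, Measurable[past W h.measurable n] (y n)) (hy4 : ∀ n, MemLp (y n) 4 P)
    (hC : ∀ n, ∫ ω, y n ω ^ 4 ∂P ≤ C) (t s : ℝ) (k : ℕ) :
    ‖(∫ ω, phase y W t (k + 1) ω ∂P)
      - (1 - (t ^ 2 * σ ^ 2 * s / 2 : ℝ)) * ∫ ω, phase y W t k ω ∂P‖ ≤
      t ^ 2 * σ ^ 2 / 2 * ‖∫ ω, phase y W t k ω * ((y k ω ^ 2 - s : ℝ) : ℂ) ∂P‖
        + 4 * |t| ^ 3 * ((1 + C) * (1 + ∫ ω, W 0 ω ^ 4 ∂P)) := by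
  have hph := h.measurable_phase hy t k
  have hy2 : ∀ n, MemLp (y n) 2 P := fun n ↦ (hy4 n).mono_exponent (by norm_num)
  have hyW2 := h.memLp_two_mul (le_refl k) (hy k) (hy2 k)
  have hyW : Integrable (fun ω ↦ y k ω * W k ω) P := hyW2.integrable (by norm_num)
  -- the remainder of the Taylor expansion
  set R : Ω → ℂ := fun ω ↦ phase y W t k ω * (Complex.exp ((t * (y k ω * W k ω) : ℝ) * Complex.I)
    - (1 + (t * (y k ω * W k ω) : ℝ) * Complex.I - ((t * (y k ω * W k ω) : ℝ) : ℂ) ^ 2 / 2)) with hR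
  have hi : (fun ω ↦ 1 + y k ω ^ 4) ⟂ᵢ[P] (fun ω ↦ 1 + W k ω ^ 4) :=
    (h.indepFun le_rfl (hy k)).comp (φ := fun x : ℝ ↦ 1 + x ^ 4) (ψ := fun x : ℝ ↦ 1 + x ^ 4)
      (by fun_prop) (by fun_prop)
  have j1 : Integrable (fun ω ↦ 1 + y k ω ^ 4) P :=
    (integrable_const 1).add (integrable_pow_four (hy4 k))
  have j2 : Integrable (fun ω ↦ 1 + W k ω ^ 4) P :=
    (integrable_const 1).add (integrable_pow_four (h.memLp' k))
  have jb : Integrable (fun ω ↦ (1 + y k ω ^ 4) * (1 + W k ω ^ 4)) P := hi.integrable_mul j1 j2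
  have hRle : ∀ ω, ‖R ω‖ ≤ 4 * |t| ^ 3 * ((1 + y k ω ^ 4) * (1 + W k ω ^ 4)) := by
    intro ω
    have hc : ∀ x : ℝ, |x| ^ 3 ≤ 1 + x ^ 4 := by
      intro x
      rw [← (show Even 4 by decide).pow_abs x]
      nlinarith [sq_nonneg (|x| ^ 2 - 1), sq_nonneg (|x| * (|x| - 1)), abs_nonneg x,
        sq_nonneg (|x| - 1), sq_nonneg (|x| ^ 2 - |x|)]
    rw [hR, norm_mul, norm_phase, one_mul]
    refine (norm_exp_mul_I_sub_taylor_le _).trans ?_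
    rw [abs_mul, abs_mul, mul_pow, mul_pow, ← mul_assoc]
    gcongr
    exacts [hc _, hc _]
  have hRint : ‖∫ ω, R ω ∂P‖ ≤ 4 * |t| ^ 3 * ((1 + C) * (1 + ∫ ω, W 0 ω ^ 4 ∂P)) := by
    refine (norm_integral_le_of_norm_le (jb.const_mul _) (Eventually.of_forall hRle)).trans ?_
    rw [integral_const_mul, hi.integral_fun_mul_eq_mul_integral j1.aestronglyMeasurable
      j2.aestronglyMeasurable, integral_add (integrable_const 1) (integrable_pow_four (hy4 k)),
      integral_add (integrable_const 1) (integrable_pow_four (h.memLp' k)), h.integral_pow k]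
    simp only [integral_const, probReal_univ, one_smul]
    have : 0 ≤ ∫ ω, W 0 ω ^ 4 ∂P := integral_nonneg fun ω ↦ by positivity
    gcongr
    exact hC k
  have hm : Measurable fun x : ℝ ↦ Complex.exp ((t * x : ℝ) * Complex.I)
      - (1 + (t * x : ℝ) * Complex.I - ((t * x : ℝ) : ℂ) ^ 2 / 2) := by fun_prop
  have jR : Integrable R P := (jb.const_mul (4 * |t| ^ 3)).mono'
    ((h.measurable_of_past hph).mul
      (hm.comp ((h.measurable_of_past (hy k)).mul (h.measurable k)))).aestronglyMeasurable
    (Eventually.of_forall hRle)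
  have e : ∀ ω, phase y W t (k + 1) ω = phase y W t k ω * ((1 : ℝ) : ℂ)
      + (t : ℂ) * Complex.I * (phase y W t k ω * ((y k ω * W k ω : ℝ) : ℂ))
      - ((t ^ 2 / 2 : ℝ) : ℂ) * (phase y W t k ω * (((y k ω * W k ω) ^ 2 : ℝ) : ℂ)) + R ω := by
    intro ω
    have : phase y W t (k + 1) ω =
        phase y W t k ω * Complex.exp ((t * (y k ω * W k ω) : ℝ) * Complex.I) := by
      rw [phase, phase, ← Complex.exp_add]
      congr 1
      simp only [martSum, Finset.sum_range_succ]
      push_cast; ring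
    rw [this, hR]
    push_cast
    ring
  have k1 := h.integrable_phase_mul hy t k (integrable_const (1 : ℝ))
  have k2 := (h.integrable_phase_mul hy t k hyW).const_mul ((t : ℂ) * Complex.I)
  have k3 := (h.integrable_phase_mul hy t k hyW2.integrable_sq).const_mul ((t ^ 2 / 2 : ℝ) : ℂ)
  have k12 := k1.add k2
  simp only [Pi.add_def] at k12
  have k123 := k12.sub k3
  simp only [Pi.sub_def] at k123
  have z1 : ∫ ω, phase y W t k ω * ((y k ω * W k ω : ℝ) : ℂ) ∂P = 0 := by
    have z := h.integral_mul_pow le_rfl (f := fun ω ↦ phase y W t k ω * (y k ω : ℂ))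
      (hph.mul (Complex.measurable_ofReal.comp (hy k))) 1
    simp only [pow_one] at z
    rw [h.integral_eq, Complex.ofReal_zero, mul_zero] at z
    rw [← z]
    refine integral_congr_ae (Eventually.of_forall fun ω ↦ ?_)
    push_cast; ring
  have z2 : ∫ ω, phase y W t k ω * (((y k ω * W k ω) ^ 2 : ℝ) : ℂ) ∂P =
      ((∫ ω, phase y W t k ω * ((y k ω ^ 2 - s : ℝ) : ℂ) ∂P)
        + s * ∫ ω, phase y W t k ω ∂P) * ((σ ^ 2 : ℝ) : ℂ) := by
    have z := h.integral_mul_pow le_rfl (f := fun ω ↦ phase y W t k ω * ((y k ω ^ 2 : ℝ) : ℂ))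
      (hph.mul (Complex.measurable_ofReal.comp ((hy k).pow_const 2))) 2
    rw [h.integral_sq] at z
    have hsplit : ∫ ω, phase y W t k ω * ((y k ω ^ 2 : ℝ) : ℂ) ∂P =
        (∫ ω, phase y W t k ω * ((y k ω ^ 2 - s : ℝ) : ℂ) ∂P)
        + s * ∫ ω, phase y W t k ω ∂P := by
      rw [← integral_const_mul, ← integral_add]
      · refine integral_congr_ae (Eventually.of_forall fun ω ↦ ?_)
        push_cast; ring
      · exact h.integrable_phase_mul hy t k ((hy2 k).integrable_sq.sub (integrable_const s))
      · refine (h.integrable_phase_mul hy t k (integrable_const s)).congr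
          (Eventually.of_forall fun ω ↦ ?_)
        simp only
        ring
    rw [← hsplit, ← z]
    refine integral_congr_ae (Eventually.of_forall fun ω ↦ ?_)
    push_cast; ring
  have hmain : (∫ ω, phase y W t (k + 1) ω ∂P)
      - (1 - (t ^ 2 * σ ^ 2 * s / 2 : ℝ)) * ∫ ω, phase y W t k ω ∂P =
      -((t ^ 2 * σ ^ 2 / 2 : ℝ) : ℂ) * (∫ ω, phase y W t k ω * ((y k ω ^ 2 - s : ℝ) : ℂ) ∂P)
        + ∫ ω, R ω ∂P := by
    simp_rw [e]
    rw [integral_add k123 jR, integral_sub k12 k3, integral_add k1 k2, integral_mul_const,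
      integral_const_mul, integral_const_mul, z1, z2]
    push_cast
    ring
  rw [hmain]
  refine (norm_add_le _ _).trans (add_le_add (le_of_eq ?_) hRint)
  rw [norm_mul, norm_neg, Complex.norm_real, Real.norm_of_nonneg (by positivity)]

/-- **Central limit theorem** for the martingale `∑ y_i W_i`, where `y_{n+2} = a y_n + W_{n+1}` has
limiting variance `s`. -/
lemma IsNoise.tendstoInDistribution_martSum (h : IsNoise W P σ)
    (hy : ∀ n, Measurable[past W h.measurable n] (y n)) (hy4 : ∀ n, MemLp (y n) 4 P)
    (hC : ∀ n, ∫ ω, y n ω ^ 4 ∂P ≤ C) (hrec : ∀ n ω, y (n + 2) ω = a * y n ω + W (n + 1) ω)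
    (ha : |a| < 1) (hs : s = a ^ 2 * s + σ ^ 2) :
    TendstoInDistribution (fun (n : ℕ) ω ↦ martSum y W n ω / √(n : ℝ)) atTop
      (fun z ↦ √(σ ^ 2 * s) * z) (fun _ ↦ P) (gaussianReal 0 1) where
  forall_aemeasurable n :=
    ((h.measurable_of_past (h.measurable_martSum hy n)).div_const _).aemeasurable
  tendsto := by
    have ha2 : 0 < 1 - a ^ 2 := by nlinarith [sq_abs a, abs_nonneg a]
    have hs0 : 0 ≤ s := by
      have : 0 ≤ (1 - a ^ 2) * s := by nlinarith [sq_nonneg σ]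
      exact nonneg_of_mul_nonneg_right this ha2
    refine ProbabilityMeasure.tendsto_iff_tendsto_charFun.2 fun t ↦ ?_
    have hlim : charFun ((gaussianReal 0 1).map fun z ↦ √(σ ^ 2 * s) * z) t =
        Complex.exp (-(t ^ 2 * σ ^ 2 * s / 2 : ℝ)) := by
      rw [gaussianReal_map_const_mul, charFun_gaussianReal]
      congr 1
      have hsq : ((√(σ ^ 2 * s) : ℝ) : ℂ) ^ 2 = σ ^ 2 * s := by
        exact_mod_cast Real.sq_sqrt (by positivity : 0 ≤ σ ^ 2 * s)
      push_cast
      rw [hsq]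
      ring
    have hcf : ∀ n : ℕ, charFun (P.map fun ω ↦ martSum y W n ω / √(n : ℝ)) t =
        ∫ ω, phase y W (t / √(n : ℝ)) n ω ∂P := by
      intro n
      rw [charFun_apply_real, integral_map
        ((h.measurable_of_past (h.measurable_martSum hy n)).div_const _).aemeasurable
        (by fun_prop)]
      refine integral_congr_ae (Eventually.of_forall fun ω ↦ ?_)
      simp only [phase]
      congr 1
      push_cast
      ring
    change Tendsto (fun n : ℕ ↦ charFun (P.map fun ω ↦ martSum y W n ω / √(n : ℝ)) t) atTop
      (𝓝 (charFun ((gaussianReal 0 1).map fun z ↦ √(σ ^ 2 * s) * z) t))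
    rw [hlim]
    simp_rw [hcf]
    set D := ∫ ω, W 0 ω ^ 4 ∂P with hD
    set K := 3 * C + 2 * D + s ^ 2 with hK
    set L := 4 * ((1 + C) * (1 + D)) with hL
    set B := 1 + C + s with hB
    -- crude uniform bound, used for the first two correlations
    have hb : ∀ u k, ‖∫ ω, phase y W u k ω * ((y k ω ^ 2 - s : ℝ) : ℂ) ∂P‖ ≤ B := by
      intro u k
      have i4 := integrable_pow_four (hy4 k)
      have ib : Integrable (fun ω ↦ (1 + s) + y k ω ^ 4) P := (integrable_const _).add i4
      refine (norm_integral_le_of_norm_le ib (Eventually.of_forall fun ω ↦ ?_)).trans ?_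
      · rw [norm_mul, norm_phase, one_mul, Complex.norm_real, Real.norm_eq_abs, abs_le]
        constructor <;> nlinarith [sq_nonneg (y k ω ^ 2 - 1), sq_nonneg (y k ω),
          sq_nonneg (y k ω ^ 2)]
      · rw [integral_add (integrable_const _) i4]
        simp only [integral_const, probReal_univ, one_smul]
        linarith [hC k]
    -- quantitative estimate at a fixed frequency
    have hest : ∀ (n : ℕ) (u : ℝ), |1 - u ^ 2 * σ ^ 2 * s / 2| ≤ 1 →
        ‖(∫ ω, phase y W u n ω ∂P) - (1 - (u ^ 2 * σ ^ 2 * s / 2 : ℝ)) ^ n‖ ≤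
          u ^ 2 * σ ^ 2 / 2 * ((2 * B + n * (|u| * K)) / (1 - a ^ 2)) + n * (|u| ^ 3 * L) := by
      intro n u hu
      have h1 := norm_sub_pow_le_sum (φ := fun k ↦ ∫ ω, phase y W u k ω ∂P)
        (by simp [phase, martSum]) hu
        (fun k ↦ h.norm_integral_phase_succ_le hy hy4 hC u s k) n
      refine h1.trans ?_
      rw [Finset.sum_add_distrib, ← Finset.mul_sum]
      have h2 := sum_le_of_two_step_contraction (fun k ↦ norm_nonneg _) (hb u)
        (fun k ↦ h.norm_integral_phase_mul_contraction hy hy4 hC hrec hs u k) n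
      rw [mul_comm, ← le_div_iff₀ ha2] at h2
      refine add_le_add (by gcongr) (le_of_eq ?_)
      simp only [Finset.sum_const, Finset.card_range, nsmul_eq_mul]
      rw [hL]
      ring
    have hinv : Tendsto (fun n : ℕ ↦ 1 / √(n : ℝ)) atTop (𝓝 0) := by
      simpa only [one_div] using! tendsto_inv_atTop_zero.comp
        (Real.tendsto_sqrt_atTop.comp tendsto_natCast_atTop_atTop)
    have hbound : Tendsto (fun n : ℕ ↦ (t / √(n : ℝ)) ^ 2 * σ ^ 2 / 2 *
        ((2 * B + n * (|t / √(n : ℝ)| * K)) / (1 - a ^ 2)) + n * (|t / √(n : ℝ)| ^ 3 * L))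
        atTop (𝓝 0) := by
      have hl : Tendsto (fun n : ℕ ↦ t ^ 2 * σ ^ 2 * B / (1 - a ^ 2) * (1 / √(n : ℝ)) ^ 2
          + (t ^ 2 * σ ^ 2 / 2 * (|t| * K) / (1 - a ^ 2) + |t| ^ 3 * L) * (1 / √(n : ℝ)))
          atTop (𝓝 0) := by
        simpa using ((hinv.pow 2).const_mul (t ^ 2 * σ ^ 2 * B / (1 - a ^ 2))).add
          (hinv.const_mul (t ^ 2 * σ ^ 2 / 2 * (|t| * K) / (1 - a ^ 2) + |t| ^ 3 * L))
      refine hl.congr' ((eventually_gt_atTop 0).mono fun n hn ↦ ?_)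
      have h0 : 0 < (n : ℝ) := by exact_mod_cast hn
      have hq : 0 < √(n : ℝ) := Real.sqrt_pos.2 h0
      have hqq : (n : ℝ) = √(n : ℝ) ^ 2 := (Real.sq_sqrt h0.le).symm
      simp only [abs_div, abs_of_pos hq]
      set z := √(n : ℝ)
      rw [hqq]
      field_simp
      ring
    have hpow : Tendsto (fun n : ℕ ↦ (1 - ((t / √(n : ℝ)) ^ 2 * σ ^ 2 * s / 2 : ℝ) : ℂ) ^ n) atTop
        (𝓝 (Complex.exp (-(t ^ 2 * σ ^ 2 * s / 2 : ℝ)))) := by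
      refine (Complex.tendsto_one_add_div_pow_exp (-(t ^ 2 * σ ^ 2 * s / 2 : ℝ))).congr fun n ↦ ?_
      congr 1
      rw [div_pow, Real.sq_sqrt (Nat.cast_nonneg n)]
      push_cast
      ring
    have hsmall : ∀ᶠ n : ℕ in atTop, |1 - (t / √(n : ℝ)) ^ 2 * σ ^ 2 * s / 2| ≤ 1 := by
      have hl : Tendsto (fun n : ℕ ↦ (t / √(n : ℝ)) ^ 2 * σ ^ 2 * s / 2) atTop (𝓝 0) := by
        have := (hinv.pow 2).const_mul (t ^ 2 * σ ^ 2 * s / 2)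
        simp only [ne_eq, OfNat.ofNat_ne_zero, not_false_eq_true, zero_pow, mul_zero] at this
        refine this.congr fun n ↦ ?_
        rw [div_pow, div_pow]; ring
      filter_upwards [hl.eventually (gt_mem_nhds (show (0 : ℝ) < 1 by norm_num))] with n hn
      have : 0 ≤ (t / √(n : ℝ)) ^ 2 * σ ^ 2 * s / 2 := by positivity
      rw [abs_le]
      constructor <;> linarith
    have hz : Tendsto (fun n : ℕ ↦ (∫ ω, phase y W (t / √(n : ℝ)) n ω ∂P)
        - (1 - ((t / √(n : ℝ)) ^ 2 * σ ^ 2 * s / 2 : ℝ) : ℂ) ^ n) atTop (𝓝 0) :=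
      squeeze_zero_norm' (hsmall.mono fun n hn ↦ hest n _ hn) hbound
    simpa using hz.add hpow

end CentralLimit

/-! ### Almost sure behaviour of the autoregressive process -/

lemma tendsto_succ_div {f : ℕ → ℝ} (h : Tendsto (fun n : ℕ ↦ f n / ((n : ℝ) + 1)) atTop (𝓝 0)) :
    Tendsto (fun n : ℕ ↦ f (n + 1) / ((n : ℝ) + 1)) atTop (𝓝 0) := by
  have h1 := ((tendsto_add_atTop_iff_nat 1).2 h).mul
    ((tendsto_const_nhds (x := (1 : ℝ))).add tendsto_one_div_add_atTop_nhds_zero_nat)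
  rw [zero_mul] at h1
  refine h1.congr fun n ↦ ?_
  push_cast
  field_simp

lemma sub_arTwoZero_recursion {θ ρ : ℝ} {x e w : ℕ → ℝ} (hx : ∀ n, x (n + 1) = θ * x n + e (n + 1))
    (he : ∀ n, e (n + 1) = ρ * e n + w n) (n : ℕ) :
    x (n + 1) - arTwoZero θ ρ w (n + 1) =
      θ * (x n - arTwoZero θ ρ w n) + ρ ^ (n + 1) * e 0 := by
  -- the noises `e` and `arZero ρ w` differ by a solution of the homogeneous recursion
  have key : ∀ m, e m - arZero ρ w m = ρ ^ m * e 0 := by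
    intro m
    induction m with
    | zero => simp [arZero]
    | succ m ih => rw [he, arZero_succ, pow_succ]; linear_combination ρ * ih
  have := key (n + 1)
  rw [hx]
  simp only [arTwoZero, arZero_succ] at this ⊢
  linear_combination this

lemma tendsto_sum_sub_div {c w : ℕ → ℝ} {v : ℕ → ℝ} {b : ℕ → ℝ} (h : Summable fun n ↦ c n * w n)
    (hb : Tendsto b atTop atTop) (hv : ∀ n, v n = ∑ i ∈ Finset.range n, c i * w i) :
    Tendsto (fun n ↦ v n / b n) atTop (𝓝 0) := by
  simp_rw [hv]
  exact h.hasSum.tendsto_sum_nat.div_atTop hb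

/-- The arbitrary initial values do not affect the sums of products with the innovations. -/
lemma path_limits {θ ρ σ : ℝ} (hθ : |θ| < 1) (hρ : |ρ| < 1) {x e w : ℕ → ℝ}
    (hx : ∀ n, x (n + 1) = θ * x n + e (n + 1)) (he : ∀ n, e (n + 1) = ρ * e n + w n)
    (hw4 : Tendsto (fun n : ℕ ↦ w n ^ 4 / ((n : ℝ) + 1)) atTop (𝓝 0))
    (hw2 : Tendsto (fun n : ℕ ↦ (∑ i ∈ Finset.range n, w i ^ 2) / n) atTop (𝓝 (σ ^ 2)))
    (h1 : Tendsto (fun n : ℕ ↦ (∑ i ∈ Finset.range n, arTwoZero θ ρ w i * w i) / n) atTop (𝓝 0))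
    (h2 : Tendsto (fun n : ℕ ↦ (∑ i ∈ Finset.range n, arTwoZero θ ρ w i * w (i + 1)) / n) atTop
      (𝓝 0)) :
    (fun n ↦ x n ^ 2) =o[atTop] (fun n : ℕ ↦ √(n : ℝ)) ∧
    (fun n ↦ w n ^ 2) =o[atTop] (fun n : ℕ ↦ √(n : ℝ)) ∧
    (fun n ↦ (∑ i ∈ Finset.range n, x i * w i) - ∑ i ∈ Finset.range n, arTwoZero θ ρ w i * w i)
      =o[atTop] (fun n : ℕ ↦ √(n : ℝ)) ∧
    Tendsto (fun n : ℕ ↦ sumSq x n / n) atTop (𝓝 (limVar θ ρ σ)) ∧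
    Tendsto (fun n : ℕ ↦ sumLagOne x n / n) atTop (𝓝 (limCorr θ ρ * limVar θ ρ σ)) ∧
    Tendsto (fun n : ℕ ↦ sumLagTwo x n / n) atTop
      (𝓝 (((θ + ρ) * limCorr θ ρ - θ * ρ) * limVar θ ρ σ)) := by
  have he4 := tendsto_pow_four_div_of_recursion hρ he hw4
  have hx4 := tendsto_pow_four_div_of_recursion hθ hx (tendsto_succ_div he4)
  have hxo := isLittleO_sq_sqrt hx4
  have hwo := isLittleO_sq_sqrt hw4
  obtain ⟨r, K, hr0, hr1, hc⟩ := exists_geometric_bound (c := fun n ↦ x n - arTwoZero θ ρ w n)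
    hθ hρ (sub_arTwoZero_recursion hx he)
  have s1 := summable_geometric_mul hr0 hr1 hc hw4
  have s2 := summable_geometric_mul (w := fun n ↦ w (n + 1)) hr0 hr1 hc (tendsto_succ_div hw4)
  have e1 : ∀ n, (∑ i ∈ Finset.range n, x i * w i)
      - ∑ i ∈ Finset.range n, arTwoZero θ ρ w i * w i =
      ∑ i ∈ Finset.range n, (x i - arTwoZero θ ρ w i) * w i := by
    intro n; rw [← Finset.sum_sub_distrib]; exact Finset.sum_congr rfl fun i _ ↦ by ring
  have e2 : ∀ n, (∑ i ∈ Finset.range n, x i * w (i + 1))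
      - ∑ i ∈ Finset.range n, arTwoZero θ ρ w i * w (i + 1) =
      ∑ i ∈ Finset.range n, (x i - arTwoZero θ ρ w i) * w (i + 1) := by
    intro n; rw [← Finset.sum_sub_distrib]; exact Finset.sum_congr rfl fun i _ ↦ by ring
  have t1 := (tendsto_sum_sub_div s1 tendsto_natCast_atTop_atTop e1).add h1
  have t2 := (tendsto_sum_sub_div s2 tendsto_natCast_atTop_atTop e2).add h2
  simp only [← add_div, sub_add_cancel, add_zero] at t1 t2
  refine ⟨hxo, hwo, ?_, tendsto_quadratic_averages hθ hρ (fun k ↦ ?_)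
    (hxo.trans isLittleO_sqrt_natCast) (hwo.trans isLittleO_sqrt_natCast) hw2 t1 t2⟩
  · refine (isLittleO_iff_tendsto' ((eventually_gt_atTop 0).mono fun n hn h ↦ ?_)).2
      (tendsto_sum_sub_div s1 (Real.tendsto_sqrt_atTop.comp tendsto_natCast_atTop_atTop) e1)
    have : √(n : ℝ) ≠ 0 := by positivity
    exact absurd h this
  · rw [hx, he]
    linear_combination -ρ * hx k

section Autoregressive

variable {Ω : Type*} [mΩ : MeasurableSpace Ω] {P : Measure Ω}
  {W : ℕ → Ω → ℝ} {σ : ℝ}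

lemma IsNoise.ae_tendsto_average_pow (h : IsNoise W P σ) (k : ℕ)
    (hk : Integrable (fun ω ↦ W 0 ω ^ k) P) :
    ∀ᵐ ω ∂P, Tendsto (fun n : ℕ ↦ (∑ i ∈ Finset.range n, W i ω ^ k) / n) atTop
      (𝓝 (∫ ω, W 0 ω ^ k ∂P)) := by
  have hm : Measurable fun x : ℝ ↦ x ^ k := by fun_prop
  exact strong_law_ae_real (fun i ω ↦ W i ω ^ k) hk
    (fun i j hij ↦ (h.indep.indepFun hij).comp hm hm) fun i ↦ (h.ident i).comp hm

variable [IsProbabilityMeasure P]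

/-- The process with zero initial values satisfies the laws of large numbers for sums of products
with the innovations. -/
lemma IsNoise.ae_arTwoZero_limits (h : IsNoise W P σ) {θ ρ : ℝ} (hθ : |θ| < 1) (hρ : |ρ| < 1) :
    ∀ᵐ ω ∂P, Tendsto (fun n : ℕ ↦ W n ω ^ 4 / ((n : ℝ) + 1)) atTop (𝓝 0) ∧
      Tendsto (fun n : ℕ ↦ (∑ i ∈ Finset.range n, W i ω ^ 2) / n) atTop (𝓝 (σ ^ 2)) ∧
      Tendsto (fun n : ℕ ↦ (∑ i ∈ Finset.range n, arTwoZero θ ρ (W · ω) i * W i ω) / n) atTop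
        (𝓝 0) ∧
      Tendsto (fun n : ℕ ↦ (∑ i ∈ Finset.range n, arTwoZero θ ρ (W · ω) i * W (i + 1) ω) / n) atTop
        (𝓝 0) := by
  obtain ⟨C, hC⟩ := h.exists_integral_arTwoZero_pow_four_le hθ hρ
  have hym := h.measurable_arTwoZero θ ρ
  have hy4 := h.memLp_arTwoZero θ ρ
  have hy2 : ∀ n, MemLp (fun ω ↦ arTwoZero θ ρ (W · ω) n) 2 P := fun n ↦
    (hy4 n).mono_exponent (by norm_num)
  have hC2 : ∀ n, ∫ ω, arTwoZero θ ρ (W · ω) n ^ 2 ∂P ≤ 1 + C := by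
    intro n
    have i4 := integrable_pow_four (hy4 n)
    calc _ ≤ ∫ ω, (1 + arTwoZero θ ρ (W · ω) n ^ 4) ∂P :=
          integral_mono (hy2 n).integrable_sq ((integrable_const 1).add i4) fun ω ↦ by
            nlinarith [sq_nonneg (arTwoZero θ ρ (W · ω) n ^ 2 - 1),
              sq_nonneg (arTwoZero θ ρ (W · ω) n)]
      _ ≤ 1 + C := by
          rw [integral_add (integrable_const 1) i4]; simpa using hC n
  have hC0 : 0 ≤ 1 + C := (integral_nonneg fun ω ↦ sq_nonneg _).trans (hC2 0)
  -- `∑ y_i W_{i+1}` is the martingale of the process delayed by one step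
  set H : ℕ → Ω → ℝ := fun n ω ↦ if n = 0 then 0 else arTwoZero θ ρ (W · ω) (n - 1) with hH
  have l2 := h.ae_tendsto_average (H := H) (C := 1 + C)
    (fun n ↦ by
      rcases n with _ | n
      · exact measurable_const
      · exact (hym n).mono ((past W h.measurable).mono n.le_succ) le_rfl)
    (fun n ↦ by
      rcases n with _ | n
      · exact memLp_const 0
      · exact hy2 n)
    (fun n ↦ by
      rcases n with _ | n
      · simpa [hH] using hC0
      · exact hC2 n)
  filter_upwards [h.ae_tendsto_average_pow 4 (integrable_pow_four h.memLp),
    h.ae_tendsto_average_pow 2 (h.memLp_two 0).integrable_sq,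
    h.ae_tendsto_average hym hy2 hC2, l2] with ω g4 g2 g1 gd
  rw [h.integral_sq] at g2
  refine ⟨tendsto_div_of_tendsto_average g4, g2, g1, ?_⟩
  have gd' := ((tendsto_add_atTop_iff_nat 1).2 gd).mul
    ((tendsto_const_nhds (x := (1 : ℝ))).add (tendsto_const_div_atTop_nhds_zero_nat (1 : ℝ)))
  rw [zero_mul] at gd'
  refine gd'.congr' ((eventually_gt_atTop 0).mono fun n hn ↦ ?_)
  have : (n : ℝ) ≠ 0 := by positivity
  rw [Finset.sum_range_succ']
  simp only [hH, Nat.succ_ne_zero, if_false, if_true, zero_mul, add_zero, Nat.add_sub_cancel]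
  push_cast
  field_simp

end Autoregressive

/-! ### The limiting autocorrelations -/

section Limits

variable {θ ρ σ : ℝ}

lemma one_add_mul_pos (hθ : |θ| < 1) (hρ : |ρ| < 1) : 0 < 1 + θ * ρ := by
  have : |θ * ρ| < 1 := by rw [abs_mul]; nlinarith [abs_nonneg θ, abs_nonneg ρ]
  linarith [(abs_lt.1 this).1]

lemma limVar_pos (hθ : |θ| < 1) (hρ : |ρ| < 1) (hσ : 0 < σ) : 0 < limVar θ ρ σ := by
  have h1 := one_add_mul_pos hθ hρ
  have h2 := one_add_mul_pos (ρ := -ρ) hθ (by rwa [abs_neg])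
  have hθ2 : 0 < 1 - θ ^ 2 := by nlinarith [sq_abs θ, abs_nonneg θ]
  have hρ2 : 0 < 1 - ρ ^ 2 := by nlinarith [sq_abs ρ, abs_nonneg ρ]
  have h3 : 0 < 1 - θ * ρ := by linarith
  unfold limVar
  positivity

lemma limCorr_sq_lt_one (hθ : |θ| < 1) (hρ : |ρ| < 1) : limCorr θ ρ ^ 2 < 1 := by
  have h1 := one_add_mul_pos hθ hρ
  have hθ2 : 0 < 1 - θ ^ 2 := by nlinarith [sq_abs θ, abs_nonneg θ]
  have hρ2 : 0 < 1 - ρ ^ 2 := by nlinarith [sq_abs ρ, abs_nonneg ρ]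
  rw [limCorr, div_pow, div_lt_one (by positivity)]
  nlinarith [mul_pos hθ2 hρ2]

/-- The limiting lag-two autocorrelation lies in `(0, 1)`. Positivity is
`θ² + θ ρ + ρ² ≥ |θ ρ| > θ² ρ²`. -/
lemma limCorrTwo_mem (hθ : |θ| < 1) (hρ : |ρ| < 1) (hθ0 : θ ≠ 0) (hρ0 : ρ ≠ 0) :
    0 < (θ + ρ) * limCorr θ ρ - θ * ρ ∧ (θ + ρ) * limCorr θ ρ - θ * ρ < 1 := by
  have h1 := one_add_mul_pos hθ hρ
  have hlt := limCorr_sq_lt_one hθ hρ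
  have e : (θ + ρ) = limCorr θ ρ * (1 + θ * ρ) := by rw [limCorr]; field_simp
  constructor
  · have e2 : (θ + ρ) * limCorr θ ρ - θ * ρ =
        (θ ^ 2 + θ * ρ + ρ ^ 2 - (θ * ρ) ^ 2) / (1 + θ * ρ) := by
      rw [limCorr]; field_simp; ring
    rw [e2]
    refine div_pos ?_ h1
    have hp : 0 < |θ * ρ| := abs_pos.2 (mul_ne_zero hθ0 hρ0)
    have hl : |θ * ρ| < 1 := by rw [abs_mul]; nlinarith [abs_nonneg θ, abs_nonneg ρ]
    have hq : (θ * ρ) ^ 2 < |θ * ρ| := by rw [← sq_abs]; nlinarith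
    rcases abs_cases (θ * ρ) with ⟨hc, _⟩ | ⟨hc, _⟩
    · nlinarith [sq_nonneg (θ - ρ), sq_nonneg (θ + ρ)]
    · nlinarith [sq_nonneg (θ - ρ), sq_nonneg (θ + ρ)]
  · rw [e]; nlinarith

lemma limCorr_sq_ne (hθ : |θ| < 1) (hρ : |ρ| < 1) (hθ0 : θ ≠ 0) (hρ0 : ρ ≠ 0) :
    limCorr θ ρ ^ 2 ≠ (θ + ρ) * limCorr θ ρ - θ * ρ := by
  have h1 := one_add_mul_pos hθ hρ
  have hlt := limCorr_sq_lt_one hθ hρ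
  have e : (θ + ρ) = limCorr θ ρ * (1 + θ * ρ) := by rw [limCorr]; field_simp
  intro h
  rw [e] at h
  have : θ * ρ * (1 - limCorr θ ρ ^ 2) = 0 := by linear_combination h
  rcases mul_eq_zero.1 this with h0 | h0
  · exact mul_ne_zero hθ0 hρ0 h0
  · linarith

end Limits

/-! ### Measurability and the limit law -/

section Law

variable {Ω : Type*} [MeasurableSpace Ω] {P : Measure Ω} [IsProbabilityMeasure P]
  {X : ℕ → Ω → ℝ}

lemma measurable_varthetaSqHat (hX : ∀ n, Measurable (X n)) (n : ℕ) :
    Measurable (varthetaSqHat X n) := by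
  unfold varthetaSqHat
  fun_prop

lemma measurable_dwStat (hX : ∀ n, Measurable (X n)) (n : ℕ) : Measurable (dwStat X n) := by
  have hr : ∀ k, Measurable fun ω ↦ residual X n k ω := by
    intro k
    unfold residual thetaHat
    split_ifs <;> fun_prop
  unfold dwStat
  fun_prop

lemma measurable_leadCoeff (hX : ∀ n, Measurable (X n)) (a : ℝ) (n : ℕ) :
    Measurable fun ω ↦ leadCoeff a (X · ω) n := by
  unfold leadCoeff residSq sumSq sumLagOne sumLagTwo
  fun_prop

/-- **Slutsky's theorem** in the form `gₙ (αₙ Uₙ + bₙ)² → g (α U)²`. -/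
lemma tendstoInDistribution_mul_sq {U α b g : ℕ → Ω → ℝ} {Ω' : Type*} [MeasurableSpace Ω']
    {Q : Measure Ω'} [IsProbabilityMeasure Q] {Z : Ω' → ℝ} {α₀ g₀ : ℝ}
    (hU : TendstoInDistribution U atTop Z (fun _ ↦ P) Q)
    (hα : ∀ n, Measurable (α n)) (hb : ∀ n, Measurable (b n)) (hg : ∀ n, Measurable (g n))
    (h : ∀ᵐ ω ∂P, Tendsto (α · ω) atTop (𝓝 α₀) ∧ Tendsto (b · ω) atTop (𝓝 0) ∧
      Tendsto (g · ω) atTop (𝓝 g₀)) :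
    TendstoInDistribution (fun n ω ↦ g n ω * (α n ω * U n ω + b n ω) ^ 2) atTop
      (fun z ↦ g₀ * (α₀ * Z z) ^ 2) (fun _ ↦ P) Q := by
  have hm : ∀ n, Measurable fun ω ↦ (α n ω, b n ω, g n ω) := fun n ↦
    (hα n).prodMk ((hb n).prodMk (hg n))
  have hY : TendstoInMeasure P (fun n ω ↦ (α n ω, b n ω, g n ω)) atTop
      (fun _ ↦ (α₀, (0 : ℝ), g₀)) :=
    tendstoInMeasure_of_tendsto_ae (fun n ↦ (hm n).aestronglyMeasurable)
      (h.mono fun ω hω ↦ hω.1.prodMk_nhds (hω.2.1.prodMk_nhds hω.2.2))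
  have := hU.continuous_comp_prodMk_of_tendstoInMeasure_const
    (g := fun p : ℝ × ℝ × ℝ × ℝ ↦ p.2.2.2 * (p.2.1 * p.1 + p.2.2.1) ^ 2) (by fun_prop) hY
    fun n ↦ (hm n).aemeasurable
  simpa only [add_zero] using this

/-- Convergence in distribution depends on the limit only through its law. -/
lemma tendstoInDistribution_id_of_map_eq {T : ℕ → Ω → ℝ} {Ω' : Type*} [MeasurableSpace Ω']
    {Q : Measure Ω'} [IsProbabilityMeasure Q] {Z : Ω' → ℝ} {ν : Measure ℝ} [IsProbabilityMeasure ν]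
    (h : TendstoInDistribution T atTop Z (fun _ ↦ P) Q) (hν : Q.map Z = ν) :
    TendstoInDistribution T atTop id (fun _ ↦ P) ν where
  forall_aemeasurable := h.forall_aemeasurable
  tendsto := by
    subst hν
    have := h.tendsto
    simpa only [Measure.map_id] using! this

end Law

end DurbinWatson

open DurbinWatson in
theorem theorem4p4 {Ω : Type*} [MeasurableSpace Ω] (P : Measure Ω) [IsProbabilityMeasure P]
    (θ ρ σ : ℝ) (hθ : |θ| < 1) (hρ : |ρ| < 1) (hσ : 0 < σ)
    (X ε V : ℕ → Ω → ℝ)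
    -- the model, with arbitrary random initial values `X 0` and `ε 0`
    (hX0 : Measurable (X 0)) (hε0 : Measurable (ε 0))
    (hX : ∀ n, 1 ≤ n → ∀ ω, X n ω = θ * X (n - 1) ω + ε n ω)
    (hε : ∀ n, 1 ≤ n → ∀ ω, ε n ω = ρ * ε (n - 1) ω + V n ω)
    -- `V 1, V 2, …` are i.i.d., centered, with variance `σ ^ 2` and a finite fourth moment
    (hVmeas : ∀ n, 1 ≤ n → Measurable (V n))
    (hVindep : iIndepFun (fun n : ℕ ↦ V (n + 1)) P)
    (hVident : ∀ n, 1 ≤ n → IdentDistrib (V n) (V 1) P P)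
    (hVmean : ∫ ω, V 1 ω ∂P = 0)
    (hVvar : variance (V 1) P = σ ^ 2)
    (hVmoment : MemLp (V 1) 4 P)
    (hθ0 : θ ≠ 0) (hρ0 : ρ ≠ 0) :
    (θ = -ρ →
      TendstoInDistribution (DurbinWatson.testStat X) atTop id (fun _ ↦ P)
        DurbinWatson.chiSquareOne) ∧
    (θ ≠ -ρ →
      ∀ᵐ ω ∂P, Tendsto (fun n ↦ DurbinWatson.testStat X n ω) atTop atTop) := by
  have hW : IsNoise (fun i ↦ V (i + 1)) P σ :=
    { measurable := fun i ↦ hVmeas (i + 1) (by omega)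
      indep := hVindep
      ident := fun i ↦ hVident (i + 1) (by omega)
      integral_eq := hVmean
      integral_sq := by
        rw [← hVvar, variance_of_integral_eq_zero (hVmeas 1 le_rfl).aemeasurable hVmean]
      memLp := hVmoment }
  have hXrec : ∀ n ω, X (n + 1) ω = θ * X n ω + ε (n + 1) ω := fun n ω ↦ hX (n + 1) (by omega) ω
  have hεrec : ∀ n ω, ε (n + 1) ω = ρ * ε n ω + V (n + 1) ω := fun n ω ↦ hε (n + 1) (by omega) ω
  have hεm : ∀ n, Measurable (ε n) := by
    intro n
    induction n with
    | zero => exact hε0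
    | succ n ih =>
      rw [show ε (n + 1) = fun ω ↦ ρ * ε n ω + V (n + 1) ω from funext (hεrec n)]
      exact (ih.const_mul ρ).add (hVmeas (n + 1) (by omega))
  have hXm : ∀ n, Measurable (X n) := by
    intro n
    induction n with
    | zero => exact hX0
    | succ n ih =>
      rw [show X (n + 1) = fun ω ↦ θ * X n ω + ε (n + 1) ω from funext (hXrec n)]
      exact (ih.const_mul θ).add (hεm (n + 1))
  have hs := limVar_pos hθ hρ hσ
  have hpath : ∀ᵐ ω ∂P, _ := (hW.ae_arTwoZero_limits hθ hρ).mono fun ω hω ↦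
    path_limits (σ := σ) hθ hρ (x := (X · ω)) (e := (ε · ω)) (hXrec · ω) (hεrec · ω)
      hω.1 hω.2.1 hω.2.2.1 hω.2.2.2
  refine ⟨fun h ↦ ?_, fun h ↦ ?_⟩
  · obtain rfl : ρ = -θ := by rw [h, neg_neg]
    set a := θ ^ 2 with ha
    set s := limVar θ (-θ) σ with hsdef
    have ha0 : 0 < a := by positivity
    have ha1 : a < 1 := by rw [ha]; nlinarith [sq_abs θ, abs_nonneg θ]
    have hsσ : (1 - a ^ 2) * s = σ ^ 2 := by
      have h1 : 1 - a ≠ 0 := by linarith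
      have h2 : 1 + a ≠ 0 := by linarith
      rw [hsdef, limVar, show 1 + θ * -θ = 1 - a by rw [ha]; ring,
        show 1 - θ * -θ = 1 + a by rw [ha]; ring, neg_sq, ← ha]
      field_simp
      ring
    obtain ⟨C, hC⟩ := hW.exists_integral_arTwoZero_pow_four_le hθ hρ
    set y : ℕ → Ω → ℝ := fun n ω ↦ arTwoZero θ (-θ) (fun i ↦ V (i + 1) ω) n with hy
    have hclt := hW.tendstoInDistribution_martSum (y := y) (a := a) (s := s)
      (hW.measurable_arTwoZero θ (-θ)) (hW.memLp_arTwoZero θ (-θ)) hC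
      (fun n ω ↦ by
        simp only [hy]
        rw [arTwoZero_recursion, ha]; ring)
      (by rw [abs_of_pos ha0]; exact ha1) (by linarith)
    have hMm : ∀ n, Measurable (martSum y (fun i ↦ V (i + 1)) n) := fun n ↦
      hW.measurable_of_past (hW.measurable_martSum (hW.measurable_arTwoZero θ (-θ)) n)
    set b : ℕ → Ω → ℝ := fun n ω ↦ √(n : ℝ) * (dwStat X n ω - 2) -
      leadCoeff a (X · ω) n * (martSum y (fun i ↦ V (i + 1)) n ω / √(n : ℝ)) with hb
    set g : ℕ → Ω → ℝ := fun n ω ↦ (1 - varthetaSqHat X n ω) /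
      (4 * varthetaSqHat X n ω ^ 2 * (1 + varthetaSqHat X n ω)) with hg
    have hcorr : limCorr θ (-θ) = 0 := by simp [limCorr]
    have hvm := measurable_varthetaSqHat hXm
    have hdm := measurable_dwStat hXm
    have hlm := measurable_leadCoeff hXm a
    -- `testStat` is exactly `g * (leadCoeff * martSum / √n + b) ^ 2`, and `b` tends to zero
    have hT := tendstoInDistribution_mul_sq (α := fun n ω ↦ leadCoeff a (X · ω) n) (b := b) (g := g)
      (α₀ := 2 * a / ((1 - a) * s)) (g₀ := (1 - a) / (4 * a ^ 2 * (1 + a))) hclt hlm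
      (fun n ↦ (((hdm n).sub_const 2).const_mul _).sub ((hlm n).mul ((hMm n).div_const _)))
      (fun n ↦ by fun_prop)
      (hpath.mono fun ω ⟨p1, p2, p3, p4, p5, p6⟩ ↦ by
        rw [hcorr] at p5 p6
        have p6' : Tendsto (fun n : ℕ ↦ sumLagTwo (X · ω) n / n) atTop (nhds (a * s)) := by
          rw [ha]; convert p6 using 2; ring
        have hlin := tendsto_linearization (X := X) (ω := ω) (a := a)
          (w := fun i ↦ V (i + 1) ω) (m := fun n ↦ martSum y (fun i ↦ V (i + 1)) n ω) hs ha1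
          (fun k ↦ by
            rw [hXrec, hεrec, ha]
            linear_combination θ * hXrec k ω) p1 p2 p3 p4 p5 p6'
        have hv := (tendsto_statistics hs (by norm_num) (p1.trans isLittleO_sqrt_natCast)
          p4 p5 p6').2.1
        exact ⟨hlin.1, hlin.2, (hv.const_sub 1).div
          (((hv.pow 2).const_mul 4).mul (hv.const_add 1)) (by positivity)⟩)
    refine tendstoInDistribution_id_of_map_eq (hT.congr (T := fun z ↦ z ^ 2)
      (fun n ↦ Eventually.of_forall fun ω ↦ ?_) (Eventually.of_forall fun z ↦ ?_)) rfl
    · have hn : (n : ℝ) = √(n : ℝ) ^ 2 := (Real.sq_sqrt n.cast_nonneg).symm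
      simp only [hb, hg, testStat, add_sub_cancel]
      rw [mul_pow, ← hn]
      ring
    · -- the normalizing constants cancel
      have h1 : 1 - a ≠ 0 := by linarith
      have h2 : 1 + a ≠ 0 := by linarith
      have hsq : √(σ ^ 2 * s) ^ 2 = (1 - a ^ 2) * s * s := by
        rw [Real.sq_sqrt (by positivity), hsσ]
      simp only [mul_pow, hsq]
      field_simp
      ring
  · obtain ⟨hq0, hq1⟩ := limCorrTwo_mem hθ hρ hθ0 hρ0
    have hr0 : limCorr θ ρ ≠ 0 :=
      div_ne_zero (fun h0 ↦ h (by linarith)) (one_add_mul_pos hθ hρ).ne'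
    exact hpath.mono fun ω ⟨p1, _, _, p4, p5, p6⟩ ↦
      tendsto_testStat_atTop hs (limCorr_sq_lt_one hθ hρ) (p1.trans isLittleO_sqrt_natCast)
        p4 p5 p6 hr0 hq0 hq1 (limCorr_sq_ne hθ hρ hθ0 hρ0)
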